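/- Let $A\in\mathbb R^{n\times n}$ be symmetric with zero diagonal and $\theta\in\mathbb R^n$. The Ising model $\mathcal D(A,\theta)$ is the distribution on $\{-1,1\}^n$ with $$\Pr[Z=z]\propto\exp\Big(\sum_{i<j}A_{ij}z_iz_j+\sum_i\theta_iz_i\Big),$$ and its width is $\lambda(A,\theta)=\max_i\big(\sum_j|A_{ij}|+|\theta_i|\big)$. **Algorithm.** The input is a sequence of samples $z^1,\dots,z^N\in\{-1,1\}^n$, a bound $\lambda$, a number $\eta$ and a number of iterations $T$. For each node $i\in[n]$, put $x^m=[z^m_{-i},1]\in\{-1,1\}^n$ and $y^m=z^m_i$, and run $T$ iterations of entropic mirror descent for $$\min_{w\in\mathbb R^n}\frac1N\sum_{m=1}^N\ln\big(1+e^{-y^m\langle w,x^m\rangle}\big)\quad\text{subject to }\|w\|_1\le W:=2\lambda,$$ as follows. Let $\hat x^m=W\cdot[x^m,-x^m,0]\in\mathbb R^{2n+1}$, $\hat y^m=(y^m+1)/2$, $\gamma=\frac1{2W}\sqrt{2\ln(2n+1)/T}$, and let $w^1\in\mathbb R^{2n+1}$ be the uniform probability vector. For $t=1,\dots,T$ let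 $$g^t=\frac1N\sum_{m=1}^N\big(\sigma(\langle w^t,\hat x^m\rangle)-\hat y^m\big)\hat x^m,\qquad \sigma(u)=\frac1{1+e^{-u}},$$ and obtain $w^{t+1}$ by dividing the vector $\big(w^t_ce^{-\gamma g^t_c}\big)_{c\in[2n+1]}$ by its $\ell_1$ norm. With $\bar w=\frac1T\sum_{t=1}^Tw^t$, the solution is $W(\bar w_{1:n}-\bar w_{(n+1):2n})\in\mathbb R^n$. Half of its coordinate belonging to node $j\ne i$ is $\hat A_{ij}$, and $\hat A_{ii}=0$. The output is $\hat A$ and the graph $\hat G$ on $[n]$ with edges $\{(i,j):i<j,\ |\hat A_{ij}|\ge\eta/2\}$. **Theorem.** There is a universal constant $C>0$ such that the following holds. 1. Let $\lambda(A,\theta)\le\lambda$, $\rho\in(0,1)$ and $\epsilon>0$. If $$T\ge C\,\frac{\lambda^2e^{12\lambda}\ln n}{\epsilon^4}\qquad\text{and}\qquad N\ge C\,\frac{\lambda^2e^{12\lambda}\ln(n/\rho)}{\epsilon^4},$$ then with probability at least $1-\rho$ over $N$ i.i.d. samples from $\mathcal D(A,\theta)$, the output of the algorithm satisfies $\max_{i,j\in[n]}|A_{ij}-\hat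 A_{ij}|\le\epsilon$. 2. Count every arithmetic operation, evaluation of $\exp$, $\ln$, $\sqrt{\cdot}$ or $|\cdot|$, comparison, memory access and loop iteration as a constant number of steps (real RAM). The direct implementation of the algorithm as one fixed program outputs $\hat A$ and $\hat G$, and for $n,N,T\ge1$ it takes $O(TNn^2)$ steps, with a universal constant. In particular, for fixed $\lambda>0$, $\rho\in(0,1)$ and $\epsilon>0$, and with $T$ and $N$ equal to the bounds in part 1 rounded up, it takes $O(n^2(\ln n)^2)=\tilde O(n^2)$ steps for $n\ge2$. -/

import Mathlib

open MeasureTheory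

noncomputable section

/-! ### The Ising model on `{-1, 1}ⁿ` (spins are elements of `ℤˣ = {1, -1}`) -/

/-- The value of a spin as a real number, `1` or `-1`. -/
def spin (s : ℤˣ) : ℝ := ((s : ℤ) : ℝ)

/-- Every set of spins is measurable. -/
instance : DiscreteMeasurableSpace ℤˣ where
  forall_measurableSet s :=
    ⟨(fun u : ℤˣ => (u : ℤ)) '' s, MeasurableSet.of_discrete,
      Set.preimage_image_eq s Units.val_injective⟩

/-- `exp (∑_{i<j} A i j z i z j + ∑ i, θ i z i)`. -/
def isingWeight {n : ℕ} (A : Matrix (Fin n) (Fin n) ℝ) (θ : Fin n → ℝ)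
    (z : Fin n → ℤˣ) : ℝ :=
  Real.exp ((∑ i, ∑ j ∈ Finset.Ioi i, A i j * spin (z i) * spin (z j))
    + ∑ i, θ i * spin (z i))

/-- The Ising model distribution `D(A, θ)`: probability proportional to `isingWeight`. -/
def isingPMF {n : ℕ} (A : Matrix (Fin n) (Fin n) ℝ) (θ : Fin n → ℝ) :
    PMF (Fin n → ℤˣ) :=
  PMF.ofFintype
    (fun z => ENNReal.ofReal (isingWeight A θ z / ∑ z', isingWeight A θ z'))
    (by
      have hpos : ∀ z, 0 < isingWeight A θ z := fun z => Real.exp_pos _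
      have hZ : 0 < ∑ z', isingWeight A θ z' :=
        Finset.sum_pos (fun z _ => hpos z) Finset.univ_nonempty
      rw [← ENNReal.ofReal_sum_of_nonneg (fun z _ => (div_pos (hpos z) hZ).le),
        ← Finset.sum_div, div_self hZ.ne', ENNReal.ofReal_one])

/-- The law of `N` i.i.d. samples from `D(A, θ)`. -/
def isingSamples {n : ℕ} (A : Matrix (Fin n) (Fin n) ℝ) (θ : Fin n → ℝ) (N : ℕ) :
    Measure (Fin N → Fin n → ℤˣ) :=
  Measure.pi fun _ => (isingPMF A θ).toMeasure

/-- The width `max_i (∑ j, |A i j| + |θ i|)`. -/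
def isingWidth {n : ℕ} (A : Matrix (Fin n) (Fin n) ℝ) (θ : Fin n → ℝ) : ℝ :=
  ⨆ i, ((∑ j, |A i j|) + |θ i|)

/-! ### Entropic mirror descent for `ℓ₁`-constrained logistic regression -/

/-- The `2n+1` coordinates of the lifted problem: `[x, -x, 0]`. -/
abbrev LiftedCoord (n : ℕ) : Type := (Fin n ⊕ Fin n) ⊕ Unit

/-- The lifted sample `[x, -x, 0] * W`. -/
def liftSample {n : ℕ} (W : ℝ) (x : Fin n → ℝ) : LiftedCoord n → ℝ :=
  Sum.elim (Sum.elim (fun j => x j * W) (fun j => -x j * W)) (fun _ => 0)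

/-- The gradient `(1/N) ∑ m, (σ(⟨w, x̂ m⟩) - ŷ m) x̂ m` with `x̂` the lifted samples and
`ŷ m = (y m + 1) / 2`. -/
def mdGradient {n N : ℕ} (W : ℝ) (x : Fin N → Fin n → ℝ) (y : Fin N → ℝ)
    (w : LiftedCoord n → ℝ) : LiftedCoord n → ℝ := fun c =>
  (1 / (N : ℝ)) * ∑ m, (Real.sigmoid (∑ c', w c' * liftSample W (x m) c') - (y m + 1) / 2)
    * liftSample W (x m) c

/-- The step size `(1 / (2W)) √(2 ln(2n+1) / T)`. -/
def mdStepSize (n : ℕ) (W : ℝ) (T : ℕ) : ℝ :=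
  1 / (2 * W) * √(2 * Real.log (2 * n + 1) / T)

/-- One update: multiply coordinatewise by `exp (-γ g)`, then divide by the `ℓ₁` norm. -/
def mdUpdate {n : ℕ} (γ : ℝ) (g w : LiftedCoord n → ℝ) : LiftedCoord n → ℝ := fun c =>
  w c * Real.exp (-γ * g c) / ∑ c', |w c' * Real.exp (-γ * g c')|

/-- The iterates; `mdIterate W T x y t` is the `(t+1)`-st one, the first is uniform. -/
def mdIterate {n N : ℕ} (W : ℝ) (T : ℕ) (x : Fin N → Fin n → ℝ) (y : Fin N → ℝ) :
    ℕ → LiftedCoord n → ℝ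
  | 0 => fun _ => 1 / (2 * n + 1)
  | t + 1 => mdUpdate (mdStepSize n W T)
      (mdGradient W x y (mdIterate W T x y t)) (mdIterate W T x y t)

/-- The average of the first `T` iterates. -/
def mdAverage {n N : ℕ} (W : ℝ) (T : ℕ) (x : Fin N → Fin n → ℝ) (y : Fin N → ℝ) :
    LiftedCoord n → ℝ := fun c =>
  (∑ t ∈ Finset.range T, mdIterate W T x y t c) / T

/-- The output of `T` iterations of mirror descent for
`min (1/N) ∑ m, ln (1 + exp (-y m ⟨w, x m⟩))` subject to `‖w‖₁ ≤ W`. -/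
def mirrorDescent {n N : ℕ} (W : ℝ) (T : ℕ) (x : Fin N → Fin n → ℝ) (y : Fin N → ℝ) :
    Fin n → ℝ := fun j =>
  (mdAverage W T x y (.inl (.inl j)) - mdAverage W T x y (.inl (.inr j))) * W

/-! ### Learning the Ising model -/

/-- The regression vector for node `i`: the spins of the other nodes together with a
constant coordinate `1`. The constant occupies the slot `i` left free by the removed spin
(so that no relabelling of the other coordinates is needed). -/
def nodeFeature {n : ℕ} (i : Fin n) (z : Fin n → ℤˣ) : Fin n → ℝ := fun j =>
  if j = i then 1 else spin (z j)

/-- The estimated weight matrix: row `i` is half of the mirror descent solution, with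
`ℓ₁` bound `2 * lam`, of the logistic regression of node `i` on the other nodes. -/
def isingEstimate {n N : ℕ} (lam : ℝ) (T : ℕ) (z : Fin N → Fin n → ℤˣ) :
    Matrix (Fin n) (Fin n) ℝ := fun i j =>
  if j = i then 0 else
    mirrorDescent (2 * lam) T (fun m => nodeFeature i (z m)) (fun m => spin (z m i)) j / 2

/-- The estimated graph, with edges `{(i,j) : i < j, |Â i j| ≥ η / 2}`. -/
def isingGraphEstimate {n N : ℕ} (lam eta : ℝ) (T : ℕ) (z : Fin N → Fin n → ℤˣ) :
    SimpleGraph (Fin n) :=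
  SimpleGraph.fromRel fun i j => i < j ∧ eta / 2 ≤ |isingEstimate lam T z i j|

/-! ### A real RAM: structured programs over natural-number registers (used as loop counters
and addresses), real registers and real arrays, with unit cost for every operation -/

namespace RealRAM

/-- Memory: natural-number registers `I`, real registers `R`, real arrays `A`. -/
structure Memory (I R A : Type) where
  nat : I → ℕ
  real : R → ℝ
  arr : A → ℕ → ℝ

/-- Index expressions. -/
inductive NExp (I : Type) : Type
  | lit (k : ℕ)
  | var (x : I)
  | add (a b : NExp I)
  | mul (a b : NExp I)

/-- Real expressions; `get a e` reads the cell `e` of the array `a`. -/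
inductive RExp (I R A : Type) : Type
  | lit (k : ℕ)
  | cast (e : NExp I)
  | var (x : R)
  | get (a : A) (e : NExp I)
  | neg (a : RExp I R A)
  | add (a b : RExp I R A)
  | sub (a b : RExp I R A)
  | mul (a b : RExp I R A)
  | div (a b : RExp I R A)
  | abs (a : RExp I R A)
  | exp (a : RExp I R A)
  | log (a : RExp I R A)
  | sqrt (a : RExp I R A)

/-- Tests. -/
inductive Test (I R A : Type) : Type
  | natEq (a b : NExp I)
  | natLt (a b : NExp I)
  | realLe (a b : RExp I R A)

/-- Commands; `forTo x e p` runs `p` with `x = 0, 1, …, e - 1`. -/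
inductive Cmd (I R A : Type) : Type
  | setNat (x : I) (e : NExp I)
  | setReal (x : R) (e : RExp I R A)
  | put (a : A) (k : NExp I) (e : RExp I R A)
  | seq (p q : Cmd I R A)
  | ite (b : Test I R A) (p q : Cmd I R A)
  | forTo (x : I) (e : NExp I) (p : Cmd I R A)

infixr:60 " ;; " => Cmd.seq

variable {I R A : Type}

instance {k : ℕ} : OfNat (NExp I) k := ⟨.lit k⟩
instance : Add (NExp I) := ⟨.add⟩
instance : Mul (NExp I) := ⟨.mul⟩
instance {k : ℕ} : OfNat (RExp I R A) k := ⟨.lit k⟩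
instance : Neg (RExp I R A) := ⟨.neg⟩
instance : Add (RExp I R A) := ⟨.add⟩
instance : Sub (RExp I R A) := ⟨.sub⟩
instance : Mul (RExp I R A) := ⟨.mul⟩
instance : Div (RExp I R A) := ⟨.div⟩

/-- Value of an index expression. -/
def NExp.eval (σ : Memory I R A) : NExp I → ℕ
  | .lit k => k
  | .var x => σ.nat x
  | .add a b => a.eval σ + b.eval σ
  | .mul a b => a.eval σ * b.eval σ

/-- Cost of evaluating an index expression: one step per symbol. -/
def NExp.cost : NExp I → ℕ
  | .lit _ => 1
  | .var _ => 1
  | .add a b => a.cost + b.cost + 1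
  | .mul a b => a.cost + b.cost + 1

/-- Value of a real expression. -/
def RExp.eval (σ : Memory I R A) : RExp I R A → ℝ
  | .lit k => (k : ℝ)
  | .cast e => (e.eval σ : ℝ)
  | .var x => σ.real x
  | .get a e => σ.arr a (e.eval σ)
  | .neg a => -a.eval σ
  | .add a b => a.eval σ + b.eval σ
  | .sub a b => a.eval σ - b.eval σ
  | .mul a b => a.eval σ * b.eval σ
  | .div a b => a.eval σ / b.eval σ
  | .abs a => |a.eval σ|
  | .exp a => Real.exp (a.eval σ)
  | .log a => Real.log (a.eval σ)
  | .sqrt a => √(a.eval σ)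

/-- Cost of evaluating a real expression: one step per symbol. -/
def RExp.cost : RExp I R A → ℕ
  | .lit _ => 1
  | .cast e => e.cost + 1
  | .var _ => 1
  | .get _ e => e.cost + 1
  | .neg a => a.cost + 1
  | .add a b => a.cost + b.cost + 1
  | .sub a b => a.cost + b.cost + 1
  | .mul a b => a.cost + b.cost + 1
  | .div a b => a.cost + b.cost + 1
  | .abs a => a.cost + 1
  | .exp a => a.cost + 1
  | .log a => a.cost + 1
  | .sqrt a => a.cost + 1

/-- Outcome of a test. -/
def Test.Holds (σ : Memory I R A) : Test I R A → Prop
  | .natEq a b => a.eval σ = b.eval σ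
  | .natLt a b => a.eval σ < b.eval σ
  | .realLe a b => a.eval σ ≤ b.eval σ

/-- Cost of a test. -/
def Test.cost : Test I R A → ℕ
  | .natEq a b => a.cost + b.cost + 1
  | .natLt a b => a.cost + b.cost + 1
  | .realLe a b => a.cost + b.cost + 1

/-- Run the loop body for the counter values `0, …, k - 1`, adding up the costs; each
iteration is charged one step in addition to the cost of the body. -/
def loop {S : Type} (body : ℕ → S → S × ℕ) : ℕ → S → S × ℕ
  | 0, σ => (σ, 0)
  | k + 1, σ =>
    let a := loop body k σ
    let b := body k a.1
    (b.1, a.2 + b.2 + 1)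

open Classical in
/-- The memory after execution of a command, and the number of steps used. -/
def Cmd.run [DecidableEq I] [DecidableEq R] [DecidableEq A] :
    Cmd I R A → Memory I R A → Memory I R A × ℕ
  | .setNat x e => fun σ =>
    ({ σ with nat := Function.update σ.nat x (e.eval σ) }, e.cost + 1)
  | .setReal x e => fun σ =>
    ({ σ with real := Function.update σ.real x (e.eval σ) }, e.cost + 1)
  | .put a k e => fun σ =>
    let cells := Function.update (σ.arr a) (k.eval σ) (e.eval σ)
    ({ σ with arr := Function.update σ.arr a cells }, k.cost + e.cost + 1)
  | .seq p q => fun σ =>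
    let s := p.run σ
    let t := q.run s.1
    (t.1, s.2 + t.2)
  | .ite b p q => fun σ =>
    let s := if b.Holds σ then p.run σ else q.run σ
    (s.1, s.2 + b.cost)
  | .forTo x e p => fun σ =>
    let s := loop (fun k τ => p.run { τ with nat := Function.update τ.nat x k }) (e.eval σ) σ
    (s.1, s.2 + e.cost + 1)

end RealRAM

/-! ### The learning algorithm as a real RAM program -/

namespace IsingProgram

open RealRAM

/-- Natural-number registers: the inputs `n, N, T` and counters. -/
inductive NReg
  | n | N | T | i | m | t | j | k
  deriving DecidableEq

/-- Real registers: the inputs `lam, eta` and auxiliary values. -/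
inductive RReg
  | lam | eta | W | gam | s | total
  deriving DecidableEq

/-- Arrays: the input samples `z`, auxiliary arrays, the outputs `Ahat` and `edge`. -/
inductive Arr
  | z | xhat | yhat | w | acc | g | Ahat | edge
  deriving DecidableEq

abbrev Prog : Type := Cmd NReg RReg Arr

/-- The register `r` as an index expression. -/
abbrev nv (r : NReg) : NExp NReg := .var r

/-- The register `r` as a real expression. -/
abbrev rv (r : RReg) : RExp NReg RReg Arr := .var r

/-- The array cell `a[e]`. -/
abbrev cell (a : Arr) (e : NExp NReg) : RExp NReg RReg Arr := .get a e

/-- `2n + 1`. -/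
abbrev dim : NExp NReg := 2 * nv .n + 1

/-- Form the lifted samples `[x, -x, 0] * W` and labels `(y + 1) / 2` for node `i`. -/
def formSamples : Prog :=
  .forTo .m (nv .N) (
    .forTo .j (nv .n) (
      .ite (.natEq (nv .j) (nv .i))
        (.setReal .s 1)
        (.setReal .s (cell .z (nv .m * nv .n + nv .j))) ;;
      .put .xhat (nv .m * dim + nv .j) (rv .s * rv .W) ;;
      .put .xhat (nv .m * dim + (nv .n + nv .j)) (-rv .s * rv .W)) ;;
    .put .xhat (nv .m * dim + 2 * nv .n) 0 ;;
    .put .yhat (nv .m) ((cell .z (nv .m * nv .n + nv .i) + 1) / 2))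

/-- Initialize `w` as the uniform distribution and set the step size. -/
def setUp : Prog :=
  .forTo .k dim (
    .put .w (nv .k) (1 / .cast dim) ;;
    .put .acc (nv .k) 0) ;;
  .setReal .gam (1 / (2 * rv .W) * .sqrt (2 * .log (.cast dim) / .cast (nv .T)))

/-- Add the current iterate to the running sum. -/
def accumulate : Prog :=
  .forTo .k dim (.put .acc (nv .k) (cell .acc (nv .k) + cell .w (nv .k)))

/-- Compute the gradient at the current iterate. -/
def gradient : Prog :=
  .forTo .k dim (.put .g (nv .k) 0) ;;
  .forTo .m (nv .N) (
    .setReal .s 0 ;;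
    .forTo .k dim (
      .setReal .s (rv .s + cell .w (nv .k) * cell .xhat (nv .m * dim + nv .k))) ;;
    .setReal .s (1 / (1 + .exp (-rv .s)) - cell .yhat (nv .m)) ;;
    .forTo .k dim (
      .put .g (nv .k) (cell .g (nv .k) + rv .s * cell .xhat (nv .m * dim + nv .k)))) ;;
  .forTo .k dim (.put .g (nv .k) (cell .g (nv .k) / .cast (nv .N)))

/-- Coordinatewise multiplicative update, then `ℓ₁` normalization. -/
def update : Prog :=
  .forTo .k dim (.put .w (nv .k) (cell .w (nv .k) * .exp (-rv .gam * cell .g (nv .k)))) ;;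
  .setReal .total 0 ;;
  .forTo .k dim (.setReal .total (rv .total + .abs (cell .w (nv .k)))) ;;
  .forTo .k dim (.put .w (nv .k) (cell .w (nv .k) / rv .total))

/-- Average, transform back, and write row `i` of the estimated weight matrix. -/
def writeRow : Prog :=
  .forTo .k dim (.put .acc (nv .k) (cell .acc (nv .k) / .cast (nv .T))) ;;
  .forTo .j (nv .n) (
    .ite (.natEq (nv .j) (nv .i))
      (.put .Ahat (nv .i * nv .n + nv .j) 0)
      (.put .Ahat (nv .i * nv .n + nv .j)
        ((cell .acc (nv .j) - cell .acc (nv .n + nv .j)) * rv .W / 2)))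

/-- Write the adjacency matrix (entries `0` and `1`) of the estimated graph. -/
def writeGraph : Prog :=
  .forTo .i (nv .n) (
    .forTo .j (nv .n) (
      .ite (.natLt (nv .i) (nv .j))
        (.setNat .k (nv .i * nv .n + nv .j))
        (.setNat .k (nv .j * nv .n + nv .i)) ;;
      .ite (.natEq (nv .i) (nv .j))
        (.put .edge (nv .i * nv .n + nv .j) 0)
        (.ite (.realLe (rv .eta / 2) (.abs (cell .Ahat (nv .k))))
          (.put .edge (nv .i * nv .n + nv .j) 1)
          (.put .edge (nv .i * nv .n + nv .j) 0))))

/-- The whole algorithm. -/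
def learnIsing : Prog :=
  .setReal .W (2 * rv .lam) ;;
  .forTo .i (nv .n) (
    formSamples ;;
    setUp ;;
    .forTo .t (nv .T) (accumulate ;; gradient ;; update) ;;
    writeRow) ;;
  writeGraph

/-- The initial memory: `n, N, T, lam, eta` in their registers, the samples in row-major
order in the array `z` (sample `m`, node `i` in cell `m * n + i`), all else `0`. -/
def input {n N : ℕ} (T : ℕ) (lam eta : ℝ) (z : Fin N → Fin n → ℤˣ) :
    Memory NReg RReg Arr where
  nat := fun
    | .n => n
    | .N => N
    | .T => T
    | _ => 0
  real := fun
    | .lam => lam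
    | .eta => eta
    | _ => 0
  arr := fun
    | .z => fun c =>
      if h : c < N * n then
        spin (z (finProdFinEquiv.symm ⟨c, h⟩).1 (finProdFinEquiv.symm ⟨c, h⟩).2)
      else 0
    | _ => fun _ => 0

/-- The memory when the program has stopped. -/
def output {n N : ℕ} (T : ℕ) (lam eta : ℝ) (z : Fin N → Fin n → ℤˣ) :
    Memory NReg RReg Arr :=
  (learnIsing.run (input T lam eta z)).1

/-- The number of steps that the program takes. -/
def steps {n N : ℕ} (T : ℕ) (lam eta : ℝ) (z : Fin N → Fin n → ℤˣ) : ℕ :=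
  (learnIsing.run (input T lam eta z)).2

end IsingProgram

end

/-!
Given the other spins, the log-odds of `z i` is twice the local field, a linear function of the
features, so the gradient of the expected logistic loss of node `i` vanishes at the true regression
vector `v`, which satisfies `‖v‖₁ ≤ 2λ`. Flipping a spin changes the probability of a
configuration by a factor of at least `e^{-2λ}`, hence the second moment matrix `M` of the features
satisfies `⟨a, M a⟩ ≥ e^{-2λ} a_j²` for each `j ≠ i`. By Hoeffding's inequality and a union bound,
with probability at least `1 - ρ` all empirical gradients at the true vectors and all empirical
second moments are within `h = √(10 ln(n/ρ) / N)` of their expectations.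

On that event, the regret bound for exponentiated gradient, applied to the monotone field
`w ↦ ∇loss(w)` with comparator `v`, bounds the average of `⟨∇loss(w t) - ∇loss(v), w t - v⟩` by
`O(λ √(ln n / T) + λ h)`. As the derivative of the sigmoid is at least `e^{-|u|}/4` and the
arguments are bounded by `2λ`, this average is at least `e^{-2λ}/4` times the empirical quadratic
form at `w̄ - v`, which is at least `e^{-2λ} (w̄_j - v_j)²` up to `O(λ² h)`. So the squared error is
of order `e^{4λ} λ (√(ln n / T) + h)`, and the stated `T` and `N` make it at most `ε²`.

For the program, each loop maintains an invariant that describes the arrays computed so far, and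
its cost is bounded by the number of iterations times the cost of one of them.
-/

namespace RealRAM

section

variable {I R A : Type}

section Eval

variable (σ : Memory I R A) (a b : NExp I) (u v : RExp I R A)

@[simp] theorem NExp.eval_one : (1 : NExp I).eval σ = 1 := rfl

@[simp] theorem NExp.eval_two : (2 : NExp I).eval σ = 2 := rfl

@[simp] theorem NExp.eval_var (x : I) : (NExp.var x).eval σ = σ.nat x := rfl

@[simp] theorem NExp.eval_add : (a + b).eval σ = a.eval σ + b.eval σ := rfl

@[simp] theorem NExp.eval_mul : (a * b).eval σ = a.eval σ * b.eval σ := rfl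

@[simp] theorem RExp.eval_zero : (0 : RExp I R A).eval σ = 0 := Nat.cast_zero

@[simp] theorem RExp.eval_one : (1 : RExp I R A).eval σ = 1 := Nat.cast_one

@[simp] theorem RExp.eval_two : (2 : RExp I R A).eval σ = 2 := rfl

@[simp] theorem RExp.eval_cast : (RExp.cast a : RExp I R A).eval σ = a.eval σ := rfl

@[simp] theorem RExp.eval_var (x : R) : (RExp.var x : RExp I R A).eval σ = σ.real x := rfl

@[simp] theorem RExp.eval_get (x : A) : (RExp.get x a : RExp I R A).eval σ = σ.arr x (a.eval σ) :=
  rfl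

@[simp] theorem RExp.eval_neg : (-u).eval σ = -u.eval σ := rfl

@[simp] theorem RExp.eval_add : (u + v).eval σ = u.eval σ + v.eval σ := rfl

@[simp] theorem RExp.eval_sub : (u - v).eval σ = u.eval σ - v.eval σ := rfl

@[simp] theorem RExp.eval_mul : (u * v).eval σ = u.eval σ * v.eval σ := rfl

@[simp] theorem RExp.eval_div : (u / v).eval σ = u.eval σ / v.eval σ := rfl

@[simp] theorem RExp.eval_abs : u.abs.eval σ = |u.eval σ| := rfl

@[simp] theorem RExp.eval_exp : u.exp.eval σ = Real.exp (u.eval σ) := rfl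

@[simp] theorem RExp.eval_log : u.log.eval σ = Real.log (u.eval σ) := rfl

@[simp] theorem RExp.eval_sqrt : u.sqrt.eval σ = √(u.eval σ) := rfl

@[simp] theorem Test.holds_natEq : (Test.natEq a b : Test I R A).Holds σ ↔ a.eval σ = b.eval σ :=
  Iff.rfl

@[simp] theorem Test.holds_natLt : (Test.natLt a b : Test I R A).Holds σ ↔ a.eval σ < b.eval σ :=
  Iff.rfl

@[simp] theorem Test.holds_realLe : (Test.realLe u v).Holds σ ↔ u.eval σ ≤ v.eval σ := Iff.rfl

end Eval

variable [DecidableEq I] [DecidableEq R] [DecidableEq A]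

section Run

variable (σ : Memory I R A) (p q : Cmd I R A)

@[simp] theorem Cmd.run_setNat_fst (x : I) (e : NExp I) :
    ((Cmd.setNat x e).run σ).1 = { σ with nat := Function.update σ.nat x (e.eval σ) } := rfl

@[simp] theorem Cmd.run_setReal_fst (x : R) (e : RExp I R A) :
    ((Cmd.setReal x e).run σ).1 = { σ with real := Function.update σ.real x (e.eval σ) } := rfl

@[simp] theorem Cmd.run_put_fst (a : A) (k : NExp I) (e : RExp I R A) :
    ((Cmd.put a k e).run σ).1 = { σ with
      arr := Function.update σ.arr a (Function.update (σ.arr a) (k.eval σ) (e.eval σ)) } := rfl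

@[simp] theorem Cmd.run_seq_fst : ((p ;; q).run σ).1 = (q.run (p.run σ).1).1 := rfl

open Classical in
@[simp] theorem Cmd.run_ite_fst (b : Test I R A) :
    ((Cmd.ite b p q).run σ).1 = if b.Holds σ then (p.run σ).1 else (q.run σ).1 := by
  simp only [Cmd.run]
  split_ifs <;> rfl

end Run

/-- Whether a command assigns to a natural-number register. -/
def Cmd.writesNat : Cmd I R A → I → Bool
  | .setNat x _, y => x = y
  | .setReal _ _, _ => false
  | .put _ _ _, _ => false
  | .seq p q, y => p.writesNat y || q.writesNat y
  | .ite _ p q, y => p.writesNat y || q.writesNat y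
  | .forTo x _ p, y => x = y || p.writesNat y

/-- Whether a command assigns to a real register. -/
def Cmd.writesReal : Cmd I R A → R → Bool
  | .setNat _ _, _ => false
  | .setReal x _, y => x = y
  | .put _ _ _, _ => false
  | .seq p q, y => p.writesReal y || q.writesReal y
  | .ite _ p q, y => p.writesReal y || q.writesReal y
  | .forTo _ _ p, y => p.writesReal y

/-- Whether a command writes to an array. -/
def Cmd.writesArr : Cmd I R A → A → Bool
  | .setNat _ _, _ => false
  | .setReal _ _, _ => false
  | .put a _ _, b => a = b
  | .seq p q, b => p.writesArr b || q.writesArr b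
  | .ite _ p q, b => p.writesArr b || q.writesArr b
  | .forTo _ _ p, b => p.writesArr b

/-- Two memories agree on everything that a command does not write. Since this depends on the
text of the command only, it is decided by evaluation. -/
structure Cmd.Frame (p : Cmd I R A) (σ τ : Memory I R A) : Prop where
  nat : ∀ y, p.writesNat y = false → τ.nat y = σ.nat y
  real : ∀ y, p.writesReal y = false → τ.real y = σ.real y
  arr : ∀ b, p.writesArr b = false → τ.arr b = σ.arr b

namespace Cmd.Frame

variable {p q : Cmd I R A} {σ τ υ : Memory I R A}

protected theorem refl : p.Frame σ σ := ⟨fun _ _ => rfl, fun _ _ => rfl, fun _ _ => rfl⟩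

theorem trans (h₁ : p.Frame σ τ) (h₂ : p.Frame τ υ) : p.Frame σ υ :=
  ⟨fun y h => (h₂.nat y h).trans (h₁.nat y h), fun y h => (h₂.real y h).trans (h₁.real y h),
    fun y h => (h₂.arr y h).trans (h₁.arr y h)⟩

theorem seq_left (h : p.Frame σ τ) : (p ;; q).Frame σ τ := by
  constructor <;> simp +contextual [writesNat, writesReal, writesArr, h.nat, h.real, h.arr]

theorem seq_right (h : q.Frame σ τ) : (p ;; q).Frame σ τ := by
  constructor <;> simp +contextual [writesNat, writesReal, writesArr, h.nat, h.real, h.arr]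

theorem forTo {x : I} {e : NExp I} (h : p.Frame σ τ) : (Cmd.forTo x e p).Frame σ τ := by
  constructor <;> simp +contextual [writesNat, writesReal, writesArr, h.nat, h.real, h.arr]

theorem counter (x : I) (e : NExp I) (p : Cmd I R A) (σ : Memory I R A) (k : ℕ) :
    (Cmd.forTo x e p).Frame σ { σ with nat := Function.update σ.nat x k } := by
  refine ⟨fun y hy => Function.update_of_ne ?_ _ _, fun _ _ => rfl, fun _ _ => rfl⟩
  rintro rfl
  simp [writesNat] at hy

end Cmd.Frame

theorem loop_induction {S : Type} {body : ℕ → S → S × ℕ} (P : ℕ → S → Prop) {K : ℕ} {σ : S}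
    (zero : P 0 σ) (succ : ∀ k < K, ∀ s, P k s → P (k + 1) (body k s).1) :
    P K (loop body K σ).1 := by
  induction K with
  | zero => exact zero
  | succ K ih => exact succ K K.lt_succ_self _ (ih fun k hk => succ k (by omega))

theorem Cmd.run_frame (p : Cmd I R A) (σ : Memory I R A) : p.Frame σ (p.run σ).1 := by
  induction p generalizing σ with
  | setNat | setReal | put =>
    constructor <;>
      simp +contextual [writesNat, writesReal, writesArr, eq_comm]
  | seq p q ihp ihq => exact (ihp σ).seq_left.trans (ihq _).seq_right
  | ite b p q ihp ihq =>
    rw [run_ite_fst]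
    split_ifs
    · exact ⟨(ihp σ).seq_left.nat, (ihp σ).seq_left.real, (ihp σ).seq_left.arr⟩
    · exact ⟨(ihq σ).seq_right.nat, (ihq σ).seq_right.real, (ihq σ).seq_right.arr⟩
  | forTo x e p ih =>
    exact loop_induction (fun _ s => (Cmd.forTo x e p).Frame σ s) .refl fun k _ s hs =>
      (hs.trans (.counter x e p s k)).trans (ih _).forTo

section Loops

variable {x : I} {e : NExp I} {p : Cmd I R A} {σ : Memory I R A} {a : A} {l : ℕ}

theorem Cmd.forTo_induction (P : ℕ → Memory I R A → Prop)
    (counter : ∀ k s v, P k s → P k { s with nat := Function.update s.nat x v })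
    (zero : P 0 σ)
    (succ : ∀ k < e.eval σ, ∀ s, (Cmd.forTo x e p).Frame σ s → s.nat x = k → P k s →
      P (k + 1) (p.run s).1) :
    P (e.eval σ) ((Cmd.forTo x e p).run σ).1 := by
  refine (loop_induction (fun k s => (Cmd.forTo x e p).Frame σ s ∧ P k s) ⟨.refl, zero⟩
    fun k hk s ⟨hs, hP⟩ => ?_).2
  have hf := hs.trans (.counter x e p s k)
  exact ⟨hf.trans (run_frame p _).forTo, succ k hk _ hf (by simp) (counter k s k hP)⟩

theorem Cmd.run_forTo_arr_of_write {k₀ : ℕ} {v : ℝ} (hk₀ : k₀ < e.eval σ)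
    (keep : ∀ k < e.eval σ, k ≠ k₀ → ∀ s, (Cmd.forTo x e p).Frame σ s → s.nat x = k →
      (p.run s).1.arr a l = s.arr a l)
    (write : ∀ s, (Cmd.forTo x e p).Frame σ s → s.nat x = k₀ → s.arr a l = σ.arr a l →
      (p.run s).1.arr a l = v) :
    ((Cmd.forTo x e p).run σ).1.arr a l = v := by
  have h := forTo_induction (x := x) (e := e) (p := p) (σ := σ)
    (fun k s => s.arr a l = if k ≤ k₀ then σ.arr a l else v)
    (fun _ _ _ h => h) (by simp) fun k hk s hf hx hs => ?_
  · rwa [if_neg hk₀.not_ge] at h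
  obtain hlt | rfl | hgt := lt_trichotomy k k₀
  · rw [keep k hk hlt.ne s hf hx, hs, if_pos hlt.le, if_pos (Nat.succ_le_of_lt hlt)]
  · rw [write s hf hx (by simpa using hs), if_neg (by omega)]
  · rw [keep k hk hgt.ne' s hf hx, hs, if_neg hgt.not_ge, if_neg (by omega)]

theorem Cmd.run_forTo_arr_of_keep
    (keep : ∀ k < e.eval σ, ∀ s, (Cmd.forTo x e p).Frame σ s → s.nat x = k →
      (p.run s).1.arr a l = s.arr a l) :
    ((Cmd.forTo x e p).run σ).1.arr a l = σ.arr a l :=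
  forTo_induction (fun _ s => s.arr a l = σ.arr a l) (fun _ _ _ h => h) rfl
    fun k hk s hf hx hs => (keep k hk s hf hx).trans hs

theorem Cmd.run_forTo_put_arr {u : RExp I R A} {v : ℝ} (hl : l < e.eval σ)
    (hu : ∀ s, (Cmd.forTo x e (.put a (.var x) u)).Frame σ s → s.nat x = l →
      s.arr a l = σ.arr a l → u.eval s = v) :
    ((Cmd.forTo x e (.put a (.var x) u)).run σ).1.arr a l = v :=
  run_forTo_arr_of_write hl (fun k _ hk s _ hx => by simp [hx, hk.symm])
    fun s hf hx hs => by simp [hx, hu s hf hx hs]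

theorem Cmd.run_forTo_add_real {r : R} {u : RExp I R A} {f : ℕ → ℝ}
    (hu : ∀ k < e.eval σ, ∀ s, (Cmd.forTo x e (.setReal r (.var r + u))).Frame σ s → s.nat x = k →
      u.eval s = f k) :
    ((Cmd.forTo x e (.setReal r (.var r + u))).run σ).1.real r
      = σ.real r + ∑ k ∈ Finset.range (e.eval σ), f k :=
  forTo_induction (fun k s => s.real r = σ.real r + ∑ l ∈ Finset.range k, f l)
    (fun _ _ _ h => h) (by simp) fun k hk s hf hx hs => by
      simp [hs, hu k hk s hf hx, Finset.sum_range_succ, add_assoc]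

end Loops

section Cost

/-- Whether an index expression mentions only registers from a given set. -/
def NExp.usesOnly (S : I → Bool) : NExp I → Bool
  | .lit _ => true
  | .var x => S x
  | .add a b => a.usesOnly S && b.usesOnly S
  | .mul a b => a.usesOnly S && b.usesOnly S

/-- Whether all loop bounds are determined by registers from a given set, which are never
assigned to. -/
def Cmd.steady (S : I → Bool) : Cmd I R A → Bool
  | .setNat x _ => !S x
  | .setReal _ _ => true
  | .put _ _ _ => true
  | .seq p q => p.steady S && q.steady S
  | .ite _ p q => p.steady S && q.steady S
  | .forTo x e p => !S x && e.usesOnly S && p.steady S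

/-- A bound on the cost of a command that charges for both branches of a test and reads all
loop bounds off the memory `σ`. -/
def Cmd.costBound (σ : Memory I R A) : Cmd I R A → ℕ
  | .setNat _ e => e.cost + 1
  | .setReal _ e => e.cost + 1
  | .put _ k e => k.cost + e.cost + 1
  | .seq p q => p.costBound σ + q.costBound σ
  | .ite b p q => p.costBound σ + q.costBound σ + b.cost
  | .forTo _ e p => e.eval σ * (p.costBound σ + 1) + e.cost + 1

variable {S : I → Bool} {σ τ : Memory I R A} {p : Cmd I R A}

omit [DecidableEq I] [DecidableEq R] [DecidableEq A] in
theorem NExp.eval_congr_of_usesOnly {e : NExp I} (he : e.usesOnly S)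
    (h : ∀ y, S y → τ.nat y = σ.nat y) : e.eval τ = e.eval σ := by
  induction e with
  | lit k => rfl
  | var x => exact h x he
  | add a b iha ihb | mul a b iha ihb =>
    simp only [usesOnly, Bool.and_eq_true] at he
    simp only [eval, iha he.1, ihb he.2]

omit [DecidableEq R] [DecidableEq A] in
theorem Cmd.writesNat_of_steady (hp : p.steady S) {y : I} (hy : S y) :
    p.writesNat y = false := by
  induction p with
  | setNat x => simpa [writesNat] using fun h : x = y => by simp [steady, h, hy] at hp
  | setReal | put => rfl
  | seq p q ihp ihq | ite b p q ihp ihq =>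
    simp only [steady, Bool.and_eq_true] at hp
    simp [writesNat, ihp hp.1, ihq hp.2]
  | forTo x e p ih =>
    simp only [steady, Bool.and_eq_true] at hp
    simpa [writesNat, ih hp.2] using fun h : x = y => by simp [h, hy] at hp

theorem Cmd.run_nat_of_steady (hp : p.steady S) {y : I} (hy : S y) :
    (p.run σ).1.nat y = σ.nat y :=
  (run_frame p σ).nat y (writesNat_of_steady hp hy)

theorem loop_snd_le {M : Type} {body : ℕ → M → M × ℕ} {P : M → Prop} {c : ℕ} {s : M} (hs : P s)
    (hbody : ∀ k s, P s → P (body k s).1 ∧ (body k s).2 ≤ c) (K : ℕ) :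
    (loop body K s).2 ≤ K * (c + 1) := by
  induction K with
  | zero => simp [loop]
  | succ K ih =>
    have hK : P (loop body K s).1 := loop_induction (fun _ => P) hs fun k _ s h => (hbody k s h).1
    have := (hbody K _ hK).2
    simp only [loop, Nat.succ_mul]
    omega

theorem Cmd.run_snd_le_costBound (hp : p.steady S) (h : ∀ y, S y → τ.nat y = σ.nat y) :
    (p.run τ).2 ≤ p.costBound σ := by
  induction p generalizing τ with
  | setNat | setReal | put => exact le_rfl
  | seq p q ihp ihq =>
    simp only [steady, Bool.and_eq_true] at hp
    exact add_le_add (ihp hp.1 h)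
      (ihq hp.2 fun y hy => (run_nat_of_steady hp.1 hy).trans (h y hy))
  | ite b p q ihp ihq =>
    simp only [steady, Bool.and_eq_true] at hp
    have hp' := ihp hp.1 h
    have hq' := ihq hp.2 h
    simp only [run, costBound]
    split_ifs <;> omega
  | forTo x e p ih =>
    simp only [steady, Bool.and_eq_true, Bool.not_eq_true'] at hp
    obtain ⟨⟨hx, he⟩, hp⟩ := hp
    have hcounter : ∀ k (s : Memory I R A), (∀ y, S y → s.nat y = σ.nat y) →
        ∀ y, S y → Function.update s.nat x k y = σ.nat y := fun k s hs y hy => by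
      rw [Function.update_of_ne (fun hyx => by simp [← hyx, hy] at hx), hs y hy]
    simp only [run, costBound, NExp.eval_congr_of_usesOnly he h]
    gcongr
    exact loop_snd_le (P := fun s => ∀ y, S y → s.nat y = σ.nat y) h (fun k s hs =>
      ⟨fun y hy => (run_nat_of_steady hp hy).trans (hcounter k s hs y hy),
        ih hp (hcounter k s hs)⟩) _

end Cost

end

end RealRAM

namespace IsingProgram

open RealRAM

theorem mul_add_ne_mul_add {d m m' r r' : ℕ} (hr : r < d) (hr' : r' < d) (h : m ≠ m') :
    m * d + r ≠ m' * d + r' := by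
  intro heq
  refine h ?_
  have hdiv := congrArg (· / d) heq
  simpa [Nat.add_div_of_dvd_right, Nat.div_eq_of_lt, hr, hr', Nat.zero_lt_of_lt hr] using hdiv

/-- The position of a lifted coordinate in the arrays of the program. -/
def liftIndex {n : ℕ} : LiftedCoord n → ℕ :=
  Sum.elim (Sum.elim (fun j => j) (fun j => n + j)) (fun _ => 2 * n)

theorem liftIndex_lt {n : ℕ} (c : LiftedCoord n) : liftIndex c < 2 * n + 1 := by
  rcases c with (j | j) | j <;> simp only [liftIndex, Sum.elim_inl, Sum.elim_inr] <;> omega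

theorem sum_range_eq_sum_liftIndex {n : ℕ} (f : ℕ → ℝ) :
    ∑ k ∈ Finset.range (2 * n + 1), f k = ∑ c : LiftedCoord n, f (liftIndex c) := by
  rw [Finset.sum_range_succ, two_mul, Finset.sum_range_add]
  simp [Finset.sum_range, liftIndex, two_mul]

section

variable {n N T i j : ℕ} {σ τ : Memory NReg RReg Arr}

/-- The array `a` holds the vector `v` in its first `2n + 1` cells. -/
def HoldsVector (a : Arr) (v : LiftedCoord n → ℝ) (σ : Memory NReg RReg Arr) : Prop :=
  ∀ c, σ.arr a (liftIndex c) = v c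

theorem HoldsVector.of_frame {a : Arr} {v : LiftedCoord n → ℝ} {p : Prog} (h : HoldsVector a v σ)
    (hf : p.Frame σ τ) (ha : p.writesArr a = false := by rfl) : HoldsVector a v τ :=
  fun c => by rw [hf.arr _ ha, h c]

theorem holdsVector_forTo_put (hn : σ.nat .n = n) {a : Arr} {u : RExp NReg RReg Arr}
    {v : LiftedCoord n → ℝ}
    (hu : ∀ c s, (Cmd.forTo .k dim (.put a (nv .k) u)).Frame σ s → s.nat .k = liftIndex c →
      s.arr a (liftIndex c) = σ.arr a (liftIndex c) → u.eval s = v c) :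
    HoldsVector a v ((Cmd.forTo .k dim (.put a (nv .k) u)).run σ).1 := fun c =>
  Cmd.run_forTo_put_arr (by simpa [hn] using liftIndex_lt c) (hu c)

end

/-! ### Forming the regression problem of a node -/

/-- The memory holds the input data and the radius. -/
structure HoldsInput {n N : ℕ} (T : ℕ) (lam eta : ℝ) (z : Fin N → Fin n → ℤˣ)
    (σ : Memory NReg RReg Arr) : Prop where
  nat_n : σ.nat .n = n
  nat_N : σ.nat .N = N
  nat_T : σ.nat .T = T
  real_W : σ.real .W = 2 * lam
  real_eta : σ.real .eta = eta
  arr_z : ∀ (m : Fin N) (j : Fin n), σ.arr .z (m * n + j) = spin (z m j)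

/-- The memory holds a logistic regression problem in lifted form, together with the radius, the
number of iterations and the step size of mirror descent. -/
structure HoldsRegression {n N : ℕ} (W : ℝ) (T : ℕ) (x : Fin N → Fin n → ℝ) (y : Fin N → ℝ)
    (σ : Memory NReg RReg Arr) : Prop where
  nat_n : σ.nat .n = n
  nat_N : σ.nat .N = N
  nat_T : σ.nat .T = T
  real_W : σ.real .W = W
  real_gam : σ.real .gam = mdStepSize n W T
  xhat : ∀ (m : Fin N) c, σ.arr .xhat (m * (2 * n + 1) + liftIndex c) = liftSample W (x m) c
  yhat : ∀ m : Fin N, σ.arr .yhat m = (y m + 1) / 2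

/-- Write the two entries of a lifted sample that belong to one coordinate. -/
abbrev formEntry : Prog :=
  .ite (.natEq (nv .j) (nv .i))
    (.setReal .s 1)
    (.setReal .s (cell .z (nv .m * nv .n + nv .j))) ;;
  .put .xhat (nv .m * dim + nv .j) (rv .s * rv .W) ;;
  .put .xhat (nv .m * dim + (nv .n + nv .j)) (-rv .s * rv .W)

/-- Write all entries of a lifted sample except the last one. -/
abbrev formRow : Prog := .forTo .j (nv .n) formEntry

section

variable {n N T : ℕ} {lam eta : ℝ} {z : Fin N → Fin n → ℤˣ} {σ τ : Memory NReg RReg Arr}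

theorem HoldsInput.of_frame {p : Prog} (h : HoldsInput T lam eta z σ) (hf : p.Frame σ τ)
    (hn : p.writesNat .n = false := by rfl) (hN : p.writesNat .N = false := by rfl)
    (hT : p.writesNat .T = false := by rfl) (hW : p.writesReal .W = false := by rfl)
    (heta : p.writesReal .eta = false := by rfl) (hz : p.writesArr .z = false := by rfl) :
    HoldsInput T lam eta z τ where
  nat_n := (hf.nat _ hn).trans h.nat_n
  nat_N := (hf.nat _ hN).trans h.nat_N
  nat_T := (hf.nat _ hT).trans h.nat_T
  real_W := (hf.real _ hW).trans h.real_W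
  real_eta := (hf.real _ heta).trans h.real_eta
  arr_z m j := by rw [hf.arr _ hz, h.arr_z]

theorem formEntry_run_of_ne {l : ℕ} (h₁ : l ≠ σ.nat .m * (2 * σ.nat .n + 1) + σ.nat .j)
    (h₂ : l ≠ σ.nat .m * (2 * σ.nat .n + 1) + (σ.nat .n + σ.nat .j)) :
    (formEntry.run σ).1.arr .xhat l = σ.arr .xhat l := by
  by_cases hij : σ.nat .j = σ.nat .i <;> simp [hij] at h₁ h₂ ⊢ <;> simp [h₁, h₂]

theorem formEntry_run {i j : Fin n} {m : Fin N} (h : HoldsInput T lam eta z σ)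
    (hi : σ.nat .i = i) (hm : σ.nat .m = m) (hj : σ.nat .j = j) :
    (formEntry.run σ).1.arr .xhat (m * (2 * n + 1) + j) = nodeFeature i (z m) j * (2 * lam) ∧
    (formEntry.run σ).1.arr .xhat (m * (2 * n + 1) + (n + j))
      = -nodeFeature i (z m) j * (2 * lam) := by
  have hne : (m : ℕ) * (2 * n + 1) + j ≠ m * (2 * n + 1) + (n + j) := by omega
  obtain rfl | hij := eq_or_ne j i
  · simp [nodeFeature, hi, hm, hj, h.nat_n, h.real_W, Function.update_of_ne hne]
  · simp [nodeFeature, hi, hm, hj, h.nat_n, h.real_W, h.arr_z, hij, Fin.val_ne_iff.mpr hij,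
      Function.update_of_ne hne]

theorem formRow_run_of_ne {l : ℕ} (hn : σ.nat .n = n)
    (h : ∀ r < 2 * n + 1, l ≠ σ.nat .m * (2 * n + 1) + r) :
    (formRow.run σ).1.arr .xhat l = σ.arr .xhat l :=
  Cmd.run_forTo_arr_of_keep fun k hk s hf hj => by
    have hk : k < n := by simpa [hn] using hk
    have hsn : s.nat .n = n := (hf.nat .n rfl).trans hn
    refine formEntry_run_of_ne ?_ ?_ <;> rw [hf.nat .m rfl, hsn, hj] <;> exact h _ (by omega)

theorem formRow_run {i : Fin n} {m : Fin N} (h : HoldsInput T lam eta z σ) (hi : σ.nat .i = i)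
    (hm : σ.nat .m = m) (j : Fin n) :
    (formRow.run σ).1.arr .xhat (m * (2 * n + 1) + j) = nodeFeature i (z m) j * (2 * lam) ∧
    (formRow.run σ).1.arr .xhat (m * (2 * n + 1) + (n + j))
      = -nodeFeature i (z m) j * (2 * lam) := by
  have hjn : (j : ℕ) < (nv .n).eval σ := by simp [h.nat_n]
  have hwrite (s) (hf : formRow.Frame σ s) (hj : s.nat .j = j) :=
    formEntry_run (h.of_frame hf) ((hf.nat .i rfl).trans hi) ((hf.nat .m rfl).trans hm) hj
  have hkeep (k) (hk : k < (nv .n).eval σ) (hkj : k ≠ j) (s) (hf : formRow.Frame σ s)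
      (hj : s.nat .j = k) (l : ℕ) (hl : l = j ∨ l = n + j) :
      (formEntry.run s).1.arr .xhat (m * (2 * n + 1) + l) = s.arr .xhat (m * (2 * n + 1) + l) := by
    have hk : k < n := by simpa [h.nat_n] using hk
    refine formEntry_run_of_ne ?_ ?_ <;>
      rw [hf.nat .m rfl, hm, (h.of_frame hf).nat_n, hj] <;> omega
  refine ⟨Cmd.run_forTo_arr_of_write hjn ?_ fun s hf hj _ => (hwrite s hf hj).1,
    Cmd.run_forTo_arr_of_write hjn ?_ fun s hf hj _ => (hwrite s hf hj).2⟩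
  · exact fun k hk hkj s hf hj => hkeep k hk hkj s hf hj _ (.inl rfl)
  · exact fun k hk hkj s hf hj => hkeep k hk hkj s hf hj _ (.inr rfl)

/-- Write the last entry of a lifted sample and the label. -/
abbrev formLabel : Prog :=
  .put .xhat (nv .m * dim + 2 * nv .n) 0 ;;
  .put .yhat (nv .m) ((cell .z (nv .m * nv .n + nv .i) + 1) / 2)

theorem formLabel_run_xhat (l : ℕ) :
    (formLabel.run σ).1.arr .xhat l
      = if l = σ.nat .m * (2 * σ.nat .n + 1) + 2 * σ.nat .n then 0 else σ.arr .xhat l := by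
  simp [Function.update_apply]

theorem formSamples_run_xhat {i : Fin n} (h : HoldsInput T lam eta z σ) (hi : σ.nat .i = i)
    (m : Fin N) (c : LiftedCoord n) :
    (formSamples.run σ).1.arr .xhat (m * (2 * n + 1) + liftIndex c)
      = liftSample (2 * lam) (nodeFeature i (z m)) c := by
  refine Cmd.run_forTo_arr_of_write (k₀ := m) (by simp [h.nat_N]) (fun k _ hkm s hf hm => ?_)
    fun s hf hm _ => ?_
  all_goals
    have hn : s.nat .n = n := (h.of_frame hf).nat_n
    have hrow := Cmd.run_frame formRow s
    refine (formLabel_run_xhat _).trans ?_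
    rw [hrow.nat .n rfl, hrow.nat .m rfl, hn, hm]
  · have hne (r) (hr : r < 2 * n + 1) := mul_add_ne_mul_add (liftIndex_lt c) hr hkm.symm
    rw [if_neg (hne _ (by omega)), formRow_run_of_ne hn (hm ▸ hne)]
  · have hrow_run := formRow_run (h.of_frame hf) ((hf.nat .i rfl).trans hi) hm
    obtain (j | j) | j := c
    · exact (if_neg (by simp [liftIndex]; omega)).trans (hrow_run j).1
    · exact (if_neg (by simp [liftIndex]; omega)).trans (hrow_run j).2
    · exact if_pos rfl

theorem formSamples_run_yhat {i : Fin n} (h : HoldsInput T lam eta z σ) (hi : σ.nat .i = i)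
    (m : Fin N) : (formSamples.run σ).1.arr .yhat m = (spin (z m i) + 1) / 2 := by
  refine Cmd.run_forTo_arr_of_write (k₀ := m) (by simp [h.nat_N]) (fun k _ hkm s hf hm => ?_)
    fun s hf hm _ => ?_
  all_goals
    change (formLabel.run (formRow.run s).1).1.arr .yhat m = _
    have hrow := Cmd.run_frame formRow s
    have hs := (h.of_frame hf).of_frame hrow
    replace hm := (hrow.nat .m rfl).trans hm
    replace hi := (hrow.nat .i rfl).trans ((hf.nat .i rfl).trans hi)
  · rw [← hrow.arr .yhat rfl]
    generalize (formRow.run s).1 = s' at *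
    simp [hm, hkm.symm]
  · generalize (formRow.run s).1 = s' at *
    simp [hm, hi, hs.nat_n, hs.arr_z]

/-- One step of the initialization loop. -/
abbrev setUpEntry : Prog := .put .w (nv .k) (1 / .cast dim) ;; .put .acc (nv .k) 0

theorem setUp_run (hn : σ.nat .n = n) :
    HoldsVector (n := n) .w (fun _ => 1 / (2 * n + 1)) (setUp.run σ).1 ∧
    HoldsVector (n := n) .acc (fun _ => 0) (setUp.run σ).1 := by
  have hc (c : LiftedCoord n) : liftIndex c < dim.eval σ := by simpa [hn] using liftIndex_lt c
  have hs (s) (hf : (Cmd.forTo .k dim setUpEntry).Frame σ s) : s.nat .n = n :=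
    (hf.nat .n rfl).trans hn
  refine ⟨fun c => ?_, fun c => ?_⟩
  · change ((Cmd.forTo .k dim setUpEntry).run σ).1.arr .w _ = _
    refine Cmd.run_forTo_arr_of_write (hc c) (fun k _ hk s _ hx => ?_) fun s hf hx _ => ?_
    · simp [hx, hk.symm]
    · simp [hx, hs s hf]
  · change ((Cmd.forTo .k dim setUpEntry).run σ).1.arr .acc _ = _
    refine Cmd.run_forTo_arr_of_write (hc c) (fun k _ hk s _ hx => ?_) fun s _ hx _ => ?_
    · simp [hx, hk.symm]
    · simp [hx]

theorem setUp_run_gam (hn : σ.nat .n = n) (hT : σ.nat .T = T) :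
    (setUp.run σ).1.real .gam = mdStepSize n (σ.real .W) T := by
  have hf := Cmd.run_frame (.forTo .k dim setUpEntry) σ
  rw [setUp, Cmd.run_seq_fst]
  generalize ((Cmd.forTo .k dim setUpEntry : Prog).run σ).1 = s at *
  simp [hf.nat .n rfl, hf.nat .T rfl, hf.real .W rfl, hn, hT, mdStepSize]

theorem holdsRegression_setUp_run {i : Fin n} (h : HoldsInput T lam eta z σ)
    (hi : σ.nat .i = i) :
    HoldsRegression (2 * lam) T (fun m => nodeFeature i (z m)) (fun m => spin (z m i))
      (setUp.run (formSamples.run σ).1).1 := by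
  have hf := Cmd.run_frame setUp (formSamples.run σ).1
  have h' := h.of_frame (Cmd.run_frame formSamples σ)
  have h'' := h'.of_frame hf
  exact {
    nat_n := h''.nat_n
    nat_N := h''.nat_N
    nat_T := h''.nat_T
    real_W := h''.real_W
    real_gam := by rw [setUp_run_gam h'.nat_n h'.nat_T, h'.real_W]
    xhat := fun m c => by rw [hf.arr .xhat rfl, formSamples_run_xhat h hi]
    yhat := fun m => by rw [hf.arr .yhat rfl, formSamples_run_yhat h hi] }

end

/-! ### Mirror descent -/

section

variable {n N T : ℕ} {W : ℝ} {x : Fin N → Fin n → ℝ} {y : Fin N → ℝ}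
  {σ τ : Memory NReg RReg Arr} {v w g : LiftedCoord n → ℝ}

theorem HoldsRegression.of_frame {p : Prog} (h : HoldsRegression W T x y σ) (hf : p.Frame σ τ)
    (hn : p.writesNat .n = false := by rfl) (hN : p.writesNat .N = false := by rfl)
    (hT : p.writesNat .T = false := by rfl) (hW : p.writesReal .W = false := by rfl)
    (hgam : p.writesReal .gam = false := by rfl) (hx : p.writesArr .xhat = false := by rfl)
    (hy : p.writesArr .yhat = false := by rfl) : HoldsRegression W T x y τ where
  nat_n := (hf.nat _ hn).trans h.nat_n
  nat_N := (hf.nat _ hN).trans h.nat_N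
  nat_T := (hf.nat _ hT).trans h.nat_T
  real_W := (hf.real _ hW).trans h.real_W
  real_gam := (hf.real _ hgam).trans h.real_gam
  xhat m c := by rw [hf.arr _ hx, h.xhat]
  yhat m := by rw [hf.arr _ hy, h.yhat]

theorem accumulate_run (hn : σ.nat .n = n) (hv : HoldsVector .acc v σ) (hw : HoldsVector .w w σ) :
    HoldsVector .acc (v + w) (accumulate.run σ).1 :=
  holdsVector_forTo_put hn fun c s hf hk hs => by simp [hk, hs, hv c, (hw.of_frame hf) c]

/-- Compute the residual of one sample. -/
abbrev residual : Prog :=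
  .setReal .s 0 ;;
  .forTo .k dim (.setReal .s (rv .s + cell .w (nv .k) * cell .xhat (nv .m * dim + nv .k))) ;;
  .setReal .s (1 / (1 + .exp (-rv .s)) - cell .yhat (nv .m))

/-- Add the contribution of one sample to the gradient. -/
abbrev addSample : Prog :=
  .forTo .k dim (
    .put .g (nv .k) (cell .g (nv .k) + rv .s * cell .xhat (nv .m * dim + nv .k)))

theorem residual_run {m : Fin N} (h : HoldsRegression W T x y σ) (hm : σ.nat .m = m)
    (hw : HoldsVector .w w σ) :
    (residual.run σ).1.real .s
      = Real.sigmoid (∑ c, w c * liftSample W (x m) c) - (y m + 1) / 2 := by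
  set σ₁ := ((Cmd.setReal .s 0 : Prog).run σ).1 with hσ₁
  set p : Prog := .forTo .k dim
    (.setReal .s (rv .s + cell .w (nv .k) * cell .xhat (nv .m * dim + nv .k)))
  have hf := Cmd.run_frame p σ₁
  have hsum : (p.run σ₁).1.real .s = ∑ c, w c * liftSample W (x m) c := by
    refine (Cmd.run_forTo_add_real (f := fun k =>
      σ.arr .w k * σ.arr .xhat (m * (2 * n + 1) + k)) fun k _ s hs hk => ?_).trans ?_
    · simp [hk, hs.nat .m rfl, hs.nat .n rfl, hs.arr .w rfl, hs.arr .xhat rfl, hσ₁, hm, h.nat_n]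
    · simp [hσ₁, h.nat_n, sum_range_eq_sum_liftIndex, hw _, h.xhat]
  change ((Cmd.setReal .s (1 / (1 + .exp (-rv .s)) - cell .yhat (nv .m)) : Prog).run
    (p.run σ₁).1).1.real .s = _
  generalize (p.run σ₁).1 = s at *
  simp [hf.nat .m rfl, hf.arr .yhat rfl, hsum, hσ₁, hm, h.yhat, Real.sigmoid_def]

theorem addSample_run {m : Fin N} (h : HoldsRegression W T x y σ) (hm : σ.nat .m = m)
    (hg : HoldsVector .g g σ) :
    HoldsVector .g (fun c => g c + σ.real .s * liftSample W (x m) c) (addSample.run σ).1 :=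
  holdsVector_forTo_put h.nat_n fun c s hf hk hs => by
    simp [hk, hs, hg c, hf.nat .m rfl, hm, hf.real .s rfl, (h.of_frame hf).nat_n,
      (h.of_frame hf).xhat]

/-- The body of the loop over the samples in `gradient`. -/
abbrev processSample : Prog :=
  .setReal .s 0 ;;
  .forTo .k dim (.setReal .s (rv .s + cell .w (nv .k) * cell .xhat (nv .m * dim + nv .k))) ;;
  .setReal .s (1 / (1 + .exp (-rv .s)) - cell .yhat (nv .m)) ;;
  addSample

theorem processSample_run {m : Fin N} (h : HoldsRegression W T x y σ) (hm : σ.nat .m = m)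
    (hw : HoldsVector .w w σ) (hg : HoldsVector .g g σ) :
    HoldsVector .g (fun c => g c +
      (Real.sigmoid (∑ c', w c' * liftSample W (x m) c') - (y m + 1) / 2) * liftSample W (x m) c)
      (processSample.run σ).1 := by
  have hf := Cmd.run_frame residual σ
  rw [← residual_run h hm hw]
  exact addSample_run (h.of_frame hf) ((hf.nat .m rfl).trans hm) (hg.of_frame hf)

theorem forTo_processSample_run (h : HoldsRegression W T x y σ) (hw : HoldsVector .w w σ)
    (hg : HoldsVector (n := n) .g 0 σ) :
    HoldsVector .g (fun c => ∑ m,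
      (Real.sigmoid (∑ c', w c' * liftSample W (x m) c') - (y m + 1) / 2) * liftSample W (x m) c)
      ((Cmd.forTo .m (nv .N) processSample).run σ).1 := by
  have hP := Cmd.forTo_induction (e := nv .N) (x := .m) (p := processSample) (σ := σ)
    (fun k s => HoldsVector .g (fun c => ∑ m ∈ Finset.range k, if hm : m < N then
      (Real.sigmoid (∑ c', w c' * liftSample W (x ⟨m, hm⟩) c') - (y ⟨m, hm⟩ + 1) / 2)
        * liftSample W (x ⟨m, hm⟩) c else 0) s)
    (fun _ _ _ h => h) (fun c => by simp only [hg c, Pi.zero_apply, Finset.sum_range_zero])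
    fun k hk s hf hm ih c => ?_
  · rw [NExp.eval_var, h.nat_N] at hP
    exact fun c => (hP c).trans (by simp only [Finset.sum_fin_eq_sum_range])
  · rw [NExp.eval_var, h.nat_N] at hk
    rw [processSample_run (m := ⟨k, hk⟩) (h.of_frame hf) hm (hw.of_frame hf) ih c]
    simp only [Finset.sum_range_succ, dif_pos hk]

/-- Divide the sum over all samples by their number. -/
abbrev average : Prog := .forTo .k dim (.put .g (nv .k) (cell .g (nv .k) / .cast (nv .N)))

theorem average_run (h : HoldsRegression W T x y σ) (hg : HoldsVector .g g σ) :
    HoldsVector .g (fun c => 1 / (N : ℝ) * g c) (average.run σ).1 :=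
  holdsVector_forTo_put h.nat_n fun c s hf hk hs => by
    simp [hk, hs, hg c, (h.of_frame hf).nat_N, div_eq_inv_mul]

/-- Set the gradient to zero. -/
abbrev clearGradient : Prog := .forTo .k dim (.put .g (nv .k) 0)

theorem gradient_run (h : HoldsRegression W T x y σ) (hw : HoldsVector .w w σ) :
    HoldsVector .g (mdGradient W x y w) (gradient.run σ).1 := by
  have hclear := Cmd.run_frame clearGradient σ
  have hzero : HoldsVector (n := n) .g 0 (clearGradient.run σ).1 :=
    holdsVector_forTo_put h.nat_n fun _ s _ _ _ => RExp.eval_zero s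
  have hsum := forTo_processSample_run (h.of_frame hclear) (hw.of_frame hclear) hzero
  have hf := Cmd.run_frame (.forTo .m (nv .N) processSample) (clearGradient.run σ).1
  rw [gradient, Cmd.run_seq_fst, Cmd.run_seq_fst]
  exact average_run ((h.of_frame hclear).of_frame hf) hsum

/-- The multiplicative part of an update. -/
abbrev multiply : Prog :=
  .forTo .k dim (.put .w (nv .k) (cell .w (nv .k) * .exp (-rv .gam * cell .g (nv .k))))

/-- Compute the `ℓ₁` norm of the iterate. -/
abbrev norm : Prog :=
  .setReal .total 0 ;; .forTo .k dim (.setReal .total (rv .total + .abs (cell .w (nv .k))))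

theorem multiply_run (hn : σ.nat .n = n) (hg : HoldsVector .g g σ) (hw : HoldsVector .w w σ) :
    HoldsVector .w (fun c => w c * Real.exp (-σ.real .gam * g c)) (multiply.run σ).1 :=
  holdsVector_forTo_put hn fun c s hf hk hs => by
    simp [hk, hs, hw c, hf.real .gam rfl, (hg.of_frame hf) c]

theorem norm_run (hn : σ.nat .n = n) (hw : HoldsVector .w w σ) :
    (norm.run σ).1.real .total = ∑ c, |w c| := by
  rw [Cmd.run_seq_fst]
  refine (Cmd.run_forTo_add_real (f := fun k => |σ.arr .w k|) fun k _ s hs hk => ?_).trans ?_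
  · simp [hk, hs.arr .w rfl]
  · simp [hn, sum_range_eq_sum_liftIndex, hw _]

/-- Divide the iterate by its norm. -/
abbrev normalize : Prog := .forTo .k dim (.put .w (nv .k) (cell .w (nv .k) / rv .total))

theorem normalize_run (hn : σ.nat .n = n) (hw : HoldsVector .w w σ) :
    HoldsVector .w (fun c => w c / σ.real .total) (normalize.run σ).1 :=
  holdsVector_forTo_put hn fun c s hf hk hs => by simp [hk, hs, hw c, hf.real .total rfl]

theorem update_run (hn : σ.nat .n = n) (hg : HoldsVector .g g σ) (hw : HoldsVector .w w σ) :
    HoldsVector .w (mdUpdate (σ.real .gam) g w) (update.run σ).1 := by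
  have hmul := Cmd.run_frame multiply σ
  have hnorm := Cmd.run_frame norm (multiply.run σ).1
  have hw' := multiply_run hn hg hw
  have h := normalize_run ((hnorm.nat .n rfl).trans ((hmul.nat .n rfl).trans hn))
    (hw'.of_frame hnorm)
  rwa [norm_run ((hmul.nat .n rfl).trans hn) hw'] at h

theorem descent_run (h : HoldsRegression W T x y σ)
    (hw : HoldsVector (n := n) .w (fun _ => 1 / (2 * n + 1)) σ)
    (hacc : HoldsVector (n := n) .acc 0 σ) :
    HoldsVector .acc (∑ t ∈ Finset.range T, mdIterate W T x y t)
      ((Cmd.forTo .t (nv .T) (accumulate ;; gradient ;; update)).run σ).1 := by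
  have hP := Cmd.forTo_induction (e := nv .T) (x := .t) (p := accumulate ;; gradient ;; update)
    (σ := σ) (fun k s => HoldsVector .w (mdIterate W T x y k) s ∧
      HoldsVector .acc (∑ t ∈ Finset.range k, mdIterate W T x y t) s)
    (fun _ _ _ h => h) ⟨hw, by simpa using hacc⟩ fun k _ s hf _ ⟨hw, hacc⟩ => ?_
  · simpa [h.nat_T] using hP.2
  have hs := h.of_frame hf
  have hf₁ := Cmd.run_frame accumulate s
  have hf₂ := Cmd.run_frame gradient (accumulate.run s).1
  have hf₃ := Cmd.run_frame update (gradient.run (accumulate.run s).1).1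
  have hs₂ := (hs.of_frame hf₁).of_frame hf₂
  have hg := gradient_run (hs.of_frame hf₁) (hw.of_frame hf₁)
  have hw' := update_run hs₂.nat_n hg ((hw.of_frame hf₁).of_frame hf₂)
  rw [hs₂.real_gam] at hw'
  rw [Finset.sum_range_succ]
  exact ⟨hw', ((accumulate_run hs.nat_n hacc hw).of_frame hf₂).of_frame hf₃⟩

end

/-! ### The output matrices -/

section

variable {n N T : ℕ} {lam eta W : ℝ} {z : Fin N → Fin n → ℤˣ} {x : Fin N → Fin n → ℝ}
  {y : Fin N → ℝ} {σ : Memory NReg RReg Arr} {v : LiftedCoord n → ℝ} {p : Prog} {a : Arr}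

/-- The array `a` holds the matrix `M` in row-major order. -/
def HoldsMatrix (a : Arr) (M : Matrix (Fin n) (Fin n) ℝ) (σ : Memory NReg RReg Arr) : Prop :=
  ∀ i j : Fin n, σ.arr a (i * n + j) = M i j

theorem HoldsMatrix.of_frame {M : Matrix (Fin n) (Fin n) ℝ} {τ : Memory NReg RReg Arr}
    (h : HoldsMatrix a M σ) (hf : p.Frame σ τ) (ha : p.writesArr a = false := by rfl) :
    HoldsMatrix a M τ :=
  fun i j => by rw [hf.arr _ ha, h i j]

/-- In `τ`, row `i` of the array `a` is `u`; the other rows are as in `σ`. -/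
structure RowUpdated (a : Arr) (i : Fin n) (u : Fin n → ℝ) (σ τ : Memory NReg RReg Arr) :
    Prop where
  keep : ∀ l, (∀ r < n, l ≠ i * n + r) → τ.arr a l = σ.arr a l
  write : ∀ j : Fin n, τ.arr a (i * n + j) = u j

theorem rowUpdated_forTo {i : Fin n} {u : Fin n → ℝ} (hn : σ.nat .n = n)
    (h : ∀ (j : Fin n) s, (Cmd.forTo .j (nv .n) p).Frame σ s → s.nat .j = j →
      (p.run s).1.arr a = Function.update (s.arr a) (i * n + j) (u j)) :
    RowUpdated a i u σ ((Cmd.forTo .j (nv .n) p).run σ).1 where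
  keep l hl := Cmd.run_forTo_arr_of_keep fun k hk s hf hj => by
    rw [NExp.eval_var, hn] at hk
    rw [h ⟨k, hk⟩ s hf hj, Function.update_of_ne (hl k hk)]
  write j := by
    refine Cmd.run_forTo_arr_of_write (k₀ := j) (by simp [hn]) (fun k hk hkj s hf hj => ?_)
      fun s hf hj _ => by rw [h j s hf hj, Function.update_self]
    rw [NExp.eval_var, hn] at hk
    rw [h ⟨k, hk⟩ s hf hj, Function.update_of_ne (by simpa using hkj.symm)]

theorem holdsMatrix_forTo {M : Matrix (Fin n) (Fin n) ℝ} (hn : σ.nat .n = n)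
    (h : ∀ (i : Fin n) s, (Cmd.forTo .i (nv .n) p).Frame σ s → s.nat .i = i →
      RowUpdated a i (M i) s (p.run s).1) :
    HoldsMatrix a M ((Cmd.forTo .i (nv .n) p).run σ).1 := fun i j => by
  refine Cmd.run_forTo_arr_of_write (k₀ := i) (by simp [hn]) (fun k hk hki s hf hi => ?_)
    fun s hf hi _ => (h i s hf hi).write j
  rw [NExp.eval_var, hn] at hk
  exact (h ⟨k, hk⟩ s hf hi).keep _ fun r hr => mul_add_ne_mul_add j.isLt hr hki.symm

/-- Divide the sum of the iterates by their number. -/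
abbrev averageIterates : Prog :=
  .forTo .k dim (.put .acc (nv .k) (cell .acc (nv .k) / .cast (nv .T)))

/-- Write one entry of the estimated weight matrix. -/
abbrev writeEntry : Prog :=
  .ite (.natEq (nv .j) (nv .i))
    (.put .Ahat (nv .i * nv .n + nv .j) 0)
    (.put .Ahat (nv .i * nv .n + nv .j)
      ((cell .acc (nv .j) - cell .acc (nv .n + nv .j)) * rv .W / 2))

theorem writeEntry_run {i j : Fin n} (h : HoldsRegression W T x y σ) (hi : σ.nat .i = i)
    (hj : σ.nat .j = j) (hv : HoldsVector .acc v σ) :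
    (writeEntry.run σ).1.arr .Ahat = Function.update (σ.arr .Ahat) (i * n + j)
      (if j = i then 0 else (v (.inl (.inl j)) - v (.inl (.inr j))) * W / 2) := by
  have hv₁ : σ.arr .acc j = v (.inl (.inl j)) := hv (.inl (.inl j))
  have hv₂ : σ.arr .acc (n + j) = v (.inl (.inr j)) := hv (.inl (.inr j))
  obtain rfl | hij := eq_or_ne j i
  · simp [hi, hj, h.nat_n]
  · simp [hi, hj, h.nat_n, h.real_W, hv₁, hv₂, hij, Fin.val_ne_iff.mpr hij]

theorem writeRow_run {i : Fin n} (h : HoldsRegression W T x y σ) (hi : σ.nat .i = i)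
    (hv : HoldsVector .acc v σ) :
    RowUpdated .Ahat i (fun j => if j = i then 0 else
      (v (.inl (.inl j)) / T - v (.inl (.inr j)) / T) * W / 2) σ (writeRow.run σ).1 := by
  have hf := Cmd.run_frame averageIterates σ
  have hv' : HoldsVector .acc (fun c => v c / T) (averageIterates.run σ).1 :=
    holdsVector_forTo_put h.nat_n fun c s hf hk hs => by
      simp [hk, hs, hv c, (h.of_frame hf).nat_T]
  have hrow := rowUpdated_forTo (p := writeEntry) (h.of_frame hf).nat_n fun j s hs hj =>
    writeEntry_run ((h.of_frame hf).of_frame hs)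
      ((hs.nat .i rfl).trans ((hf.nat .i rfl).trans hi)) hj (hv'.of_frame hs)
  exact ⟨fun l hl => (hrow.keep l hl).trans (congrFun (hf.arr .Ahat rfl) l), hrow.write⟩

/-- Compute one row of the estimated weight matrix. -/
abbrev learnRow : Prog :=
  formSamples ;; setUp ;; .forTo .t (nv .T) (accumulate ;; gradient ;; update) ;; writeRow

theorem learnRow_run {i : Fin n} (h : HoldsInput T lam eta z σ) (hi : σ.nat .i = i) :
    RowUpdated .Ahat i (isingEstimate lam T z i) σ (learnRow.run σ).1 := by
  have hreg := holdsRegression_setUp_run h hi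
  have hvec := setUp_run (h.of_frame (Cmd.run_frame formSamples σ)).nat_n
  have hf := (Cmd.run_frame formSamples σ).seq_left.trans
    (Cmd.run_frame setUp (formSamples.run σ).1).seq_right
  set σ₁ := (setUp.run (formSamples.run σ).1).1
  have hacc := descent_run hreg hvec.1 hvec.2
  have hf' := Cmd.run_frame (.forTo .t (nv .T) (accumulate ;; gradient ;; update)) σ₁
  have hrow := writeRow_run (hreg.of_frame hf')
    ((hf'.nat .i rfl).trans ((hf.nat .i rfl).trans hi)) hacc
  rw [Cmd.run_seq_fst, Cmd.run_seq_fst, Cmd.run_seq_fst]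
  refine ⟨fun l hl => ?_, fun j => ?_⟩
  · rw [hrow.keep l hl, hf'.arr .Ahat rfl, hf.arr .Ahat rfl]
  · rw [hrow.write]
    simp only [isingEstimate, mirrorDescent, mdAverage, Finset.sum_apply]

theorem isingGraphEstimate_adj {i j : Fin n} : (isingGraphEstimate lam eta T z).Adj i j ↔
    i ≠ j ∧ eta / 2 ≤ |isingEstimate lam T z (min i j) (max i j)| := by
  rw [isingGraphEstimate, SimpleGraph.fromRel_adj]
  refine and_congr_right fun hij => ?_
  obtain hlt | hlt := hij.lt_or_gt <;> simp [hlt, hlt.not_gt, hlt.le]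

/-- Compute the address of the entry of `Ahat` that decides about an edge. -/
abbrev locateEdge : Prog :=
  .ite (.natLt (nv .i) (nv .j))
    (.setNat .k (nv .i * nv .n + nv .j))
    (.setNat .k (nv .j * nv .n + nv .i))

/-- Write one entry of the adjacency matrix, given the address computed by `locateEdge`. -/
abbrev decideEdge : Prog :=
  .ite (.natEq (nv .i) (nv .j))
    (.put .edge (nv .i * nv .n + nv .j) 0)
    (.ite (.realLe (rv .eta / 2) (.abs (cell .Ahat (nv .k))))
      (.put .edge (nv .i * nv .n + nv .j) 1)
      (.put .edge (nv .i * nv .n + nv .j) 0))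

theorem locateEdge_run {i j : Fin n} (hn : σ.nat .n = n) (hi : σ.nat .i = i)
    (hj : σ.nat .j = j) :
    (locateEdge.run σ).1.nat .k = (min i j : Fin n) * n + (max i j : Fin n) := by
  obtain hij | hij := lt_or_ge i j
  · simp [hn, hi, hj, hij, hij.le]
  · simp [hn, hi, hj, hij, hij.not_gt]

open Classical in
theorem decideEdge_run {i j : Fin n} (h : HoldsInput T lam eta z σ)
    (hA : HoldsMatrix .Ahat (isingEstimate lam T z) σ) (hi : σ.nat .i = i) (hj : σ.nat .j = j)
    (hk : σ.nat .k = (min i j : Fin n) * n + (max i j : Fin n)) :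
    (decideEdge.run σ).1.arr .edge = Function.update (σ.arr .edge) (i * n + j)
      ((isingGraphEstimate lam eta T z).adjMatrix ℝ i j) := by
  have hvalue := hA (min i j) (max i j)
  rw [← hk] at hvalue
  rw [SimpleGraph.adjMatrix_apply, isingGraphEstimate_adj]
  obtain rfl | hij := eq_or_ne i j
  · simp [hi, hj, h.nat_n]
  · by_cases hle : eta / 2 ≤ |isingEstimate lam T z (min i j) (max i j)| <;>
      simp [hi, hj, h.nat_n, h.real_eta, hvalue, hij, Fin.val_ne_iff.mpr hij, hle]

open Classical in
theorem writeGraph_run (h : HoldsInput T lam eta z σ)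
    (hA : HoldsMatrix .Ahat (isingEstimate lam T z) σ) :
    HoldsMatrix .edge ((isingGraphEstimate lam eta T z).adjMatrix ℝ) (writeGraph.run σ).1 :=
  holdsMatrix_forTo h.nat_n fun i s hf hi =>
    rowUpdated_forTo (h.of_frame hf).nat_n fun j s' hf' hj => by
      have hl := Cmd.run_frame locateEdge s'
      have hs' := (h.of_frame hf).of_frame hf'
      have hi' := (hf'.nat .i rfl).trans hi
      rw [Cmd.run_seq_fst, ← hl.arr .edge rfl]
      exact decideEdge_run (hs'.of_frame hl) (((hA.of_frame hf).of_frame hf').of_frame hl)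
        ((hl.nat .i rfl).trans hi') ((hl.nat .j rfl).trans hj) (locateEdge_run hs'.nat_n hi' hj)

variable (T lam eta z)

theorem input_arr_z (m : Fin N) (j : Fin n) :
    (input T lam eta z).arr .z (m * n + j) = spin (z m j) := by
  have hlt : (m : ℕ) * n + j < N * n := by
    have := Nat.mul_le_mul_right n (Nat.succ_le_of_lt m.isLt)
    rw [Nat.succ_mul] at this
    omega
  have hinv : finProdFinEquiv.symm ⟨(m : ℕ) * n + j, hlt⟩ = (m, j) := by
    rw [Equiv.symm_apply_eq]
    ext
    simp [finProdFinEquiv, mul_comm, add_comm]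
  simp only [input, dif_pos hlt, hinv]

theorem holdsInput_setReal_input :
    HoldsInput T lam eta z ((Cmd.setReal .W (2 * rv .lam) : Prog).run (input T lam eta z)).1 where
  nat_n := rfl
  nat_N := rfl
  nat_T := rfl
  real_W := by simp [input]
  real_eta := rfl
  arr_z := input_arr_z T lam eta z

theorem holdsMatrix_learnRow_input :
    HoldsMatrix .Ahat (isingEstimate lam T z) ((Cmd.forTo .i (nv .n) learnRow).run
      ((Cmd.setReal .W (2 * rv .lam) : Prog).run (input T lam eta z)).1).1 :=
  have h := holdsInput_setReal_input T lam eta z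
  holdsMatrix_forTo h.nat_n fun _ _ hf hi => learnRow_run (h.of_frame hf) hi

theorem holdsMatrix_Ahat_output :
    HoldsMatrix .Ahat (isingEstimate lam T z) (output T lam eta z) := by
  have hA := (holdsMatrix_learnRow_input T lam eta z).of_frame (Cmd.run_frame writeGraph _)
  rwa [output, learnIsing, Cmd.run_seq_fst, Cmd.run_seq_fst]

open Classical in
theorem holdsMatrix_edge_output :
    HoldsMatrix .edge ((isingGraphEstimate lam eta T z).adjMatrix ℝ) (output T lam eta z) := by
  have h := (holdsInput_setReal_input T lam eta z).of_frame
    (Cmd.run_frame (.forTo .i (nv .n) learnRow) _)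
  have hedge := writeGraph_run h (holdsMatrix_learnRow_input T lam eta z)
  rwa [output, learnIsing, Cmd.run_seq_fst, Cmd.run_seq_fst]

/-- The registers that hold the sizes of the input. -/
def isSize : NReg → Bool
  | .n => true
  | .N => true
  | .T => true
  | _ => false

end

theorem steps_le {n N T : ℕ} (lam eta : ℝ) (z : Fin N → Fin n → ℤˣ) (hn : 1 ≤ n) (hN : 1 ≤ N)
    (hT : 1 ≤ T) : steps T lam eta z ≤ 2000 * (T * N * n ^ 2) := by
  refine (Cmd.run_snd_le_costBound (S := isSize) rfl (σ := input T lam eta z)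
    fun _ _ => rfl).trans ?_
  obtain ⟨a, rfl⟩ := Nat.exists_eq_add_of_le hn
  obtain ⟨b, rfl⟩ := Nat.exists_eq_add_of_le hN
  obtain ⟨c, rfl⟩ := Nat.exists_eq_add_of_le hT
  have hdim : dim.eval (input (1 + c) lam eta z) = 2 * (1 + a) + 1 := rfl
  have hn' : (nv .n).eval (input (1 + c) lam eta z) = 1 + a := rfl
  have hN' : (nv .N).eval (input (1 + c) lam eta z) = 1 + b := rfl
  have hT' : (nv .T).eval (input (1 + c) lam eta z) = 1 + c := rfl
  have hsub (u v : RExp NReg RReg Arr) : (u - v).cost = u.cost + v.cost + 1 := rfl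
  have hdiv (u v : RExp NReg RReg Arr) : (u / v).cost = u.cost + v.cost + 1 := rfl
  simp only [learnIsing, formSamples, setUp, accumulate, gradient, update, writeRow, writeGraph,
    Cmd.costBound, hdim, hn', hN', hT', NExp.cost, RExp.cost, hsub, hdiv, Test.cost]
  -- Expanded in `a`, `b`, `c`, the inequality holds coefficient by coefficient.
  ring_nf
  omega

end IsingProgram

open scoped Matrix

/-! ### Exponentiated gradient -/

section ExponentiatedGradient

variable {ι : Type*} [Fintype ι]

open ProbabilityTheory in
theorem sum_mul_exp_mul_le {w g : ι → ℝ} (hw : w ∈ stdSimplex ℝ ι) {G : ℝ}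
    (hg : ∀ c, |g c| ≤ G) (s : ℝ) :
    ∑ c, w c * Real.exp (s * g c) ≤ Real.exp (s * (g ⬝ᵥ w) + s ^ 2 * G ^ 2 / 2) := by
  let _ : MeasurableSpace ι := ⊤
  have : DiscreteMeasurableSpace ι := ⟨fun _ => trivial⟩
  let p : PMF ι := PMF.ofFintype (fun c => ENNReal.ofReal (w c)) (by
    rw [← ENNReal.ofReal_sum_of_nonneg fun c _ => hw.1 c, hw.2, ENNReal.ofReal_one])
  have hp : ∀ c, (p c).toReal = w c := fun c => ENNReal.toReal_ofReal (hw.1 c)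
  have hmean : ∫ c, g c ∂p.toMeasure = g ⬝ᵥ w := by
    simp [PMF.integral_eq_sum, hp, dotProduct, mul_comm]
  have hmgf := (hasSubgaussianMGF_of_mem_Icc (μ := p.toMeasure) (X := g) (a := -G) (b := G)
    Measurable.of_discrete.aemeasurable
    (Filter.Eventually.of_forall fun c => abs_le.1 (hg c))).mgf_le s
  have hvar : (((‖G - -G‖₊ / 2) ^ 2 : NNReal) : ℝ) = G ^ 2 := by
    simp only [NNReal.coe_pow, NNReal.coe_div, coe_nnnorm, Real.norm_eq_abs, NNReal.coe_ofNat,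
      div_pow, sq_abs]
    ring
  rw [mgf, PMF.integral_eq_sum, hmean, hvar] at hmgf
  calc ∑ c, w c * Real.exp (s * g c)
      = Real.exp (s * (g ⬝ᵥ w)) * ∑ c, (p c).toReal • Real.exp (s * (g c - g ⬝ᵥ w)) := by
        rw [Finset.mul_sum]
        refine Finset.sum_congr rfl fun c _ => ?_
        rw [hp, smul_eq_mul, mul_left_comm, ← Real.exp_add]
        ring_nf
    _ ≤ Real.exp (s * (g ⬝ᵥ w)) * Real.exp (G ^ 2 * s ^ 2 / 2) := by gcongr
    _ = Real.exp (s * (g ⬝ᵥ w) + s ^ 2 * G ^ 2 / 2) := by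
        rw [← Real.exp_add, mul_comm (G ^ 2)]

/-- One step of exponentiated gradient descent (entropic mirror descent on the simplex). -/
noncomputable def expGradStep (γ : ℝ) (g w : ι → ℝ) : ι → ℝ := fun c =>
  w c * Real.exp (-γ * g c) / ∑ c', w c' * Real.exp (-γ * g c')

/-- Exponentiated gradient descent against an arbitrary sequence `g` of loss vectors, started at
the uniform probability vector. -/
noncomputable def expGradIterate (γ : ℝ) (g : ℕ → ι → ℝ) : ℕ → ι → ℝ
  | 0 => fun _ => 1 / Fintype.card ι
  | t + 1 => expGradStep γ (g t) (expGradIterate γ g t)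

variable [Nonempty ι] {γ G : ℝ} {w u : ι → ℝ}

theorem sum_mul_exp_pos (hw : ∀ c, 0 < w c) (f : ι → ℝ) : 0 < ∑ c, w c * Real.exp (f c) :=
  Finset.sum_pos (fun c _ => mul_pos (hw c) (Real.exp_pos _)) Finset.univ_nonempty

theorem expGradStep_pos (hw : ∀ c, 0 < w c) (γ : ℝ) (g : ι → ℝ) (c : ι) :
    0 < expGradStep γ g w c :=
  div_pos (mul_pos (hw c) (Real.exp_pos _)) (sum_mul_exp_pos hw _)

theorem expGradStep_mem_stdSimplex (hw : ∀ c, 0 < w c) (γ : ℝ) (g : ι → ℝ) :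
    expGradStep γ g w ∈ stdSimplex ℝ ι := by
  refine ⟨fun c => (expGradStep_pos hw γ g c).le, ?_⟩
  simp only [expGradStep, ← Finset.sum_div]
  exact div_self (sum_mul_exp_pos hw _).ne'

theorem expGradIterate_pos (γ : ℝ) (g : ℕ → ι → ℝ) (t : ℕ) (c : ι) :
    0 < expGradIterate γ g t c := by
  induction t generalizing c with
  | zero => exact one_div_pos.2 (Nat.cast_pos.2 Fintype.card_pos)
  | succ t ih => exact expGradStep_pos ih γ (g t) c

theorem expGradIterate_mem_stdSimplex (γ : ℝ) (g : ℕ → ι → ℝ) (t : ℕ) :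
    expGradIterate γ g t ∈ stdSimplex ℝ ι := by
  cases t with
  | zero =>
    refine ⟨fun c => (expGradIterate_pos γ g 0 c).le, ?_⟩
    simp [expGradIterate]
  | succ t => exact expGradStep_mem_stdSimplex (expGradIterate_pos γ g t) γ (g t)

theorem log_expGradStep (hw : ∀ c, 0 < w c) (γ : ℝ) (g : ι → ℝ) (c : ι) :
    Real.log (expGradStep γ g w c)
      = Real.log (w c) - γ * g c - Real.log (∑ c', w c' * Real.exp (-γ * g c')) := by
  rw [expGradStep, Real.log_div (mul_pos (hw c) (Real.exp_pos _)).ne' (sum_mul_exp_pos hw _).ne',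
    Real.log_mul (hw c).ne' (Real.exp_pos _).ne', Real.log_exp]
  ring

/-- The potential of the regret analysis is the cross entropy of `w` relative to `u`. -/
theorem mul_dotProduct_sub_le_expGradStep (hw : ∀ c, 0 < w c) (hw₁ : ∑ c, w c = 1)
    (hu₁ : ∑ c, u c = 1) {g : ι → ℝ} (hg : ∀ c, |g c| ≤ G) :
    γ * (g ⬝ᵥ (w - u)) ≤ ∑ c, u c * Real.log (expGradStep γ g w c)
      - ∑ c, u c * Real.log (w c) + γ ^ 2 * G ^ 2 / 2 := by
  set Z := ∑ c, w c * Real.exp (-γ * g c) with hZ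
  have hlogZ : Real.log Z ≤ -γ * (g ⬝ᵥ w) + γ ^ 2 * G ^ 2 / 2 := by
    rw [Real.log_le_iff_le_exp (sum_mul_exp_pos hw _), ← neg_sq γ]
    exact sum_mul_exp_mul_le ⟨fun c => (hw c).le, hw₁⟩ hg (-γ)
  have hpotential : ∑ c, u c * Real.log (expGradStep γ g w c)
      = ∑ c, u c * Real.log (w c) - γ * (g ⬝ᵥ u) - Real.log Z := by
    rw [dotProduct_comm]
    simp only [log_expGradStep hw, ← hZ, mul_sub, mul_left_comm _ γ, Finset.sum_sub_distrib,
      ← Finset.mul_sum, ← Finset.sum_mul, hu₁, one_mul, dotProduct]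
  rw [hpotential, dotProduct_sub]
  linarith

theorem mul_sum_dotProduct_sub_le_expGradIterate {g : ℕ → ι → ℝ} (hu : u ∈ stdSimplex ℝ ι)
    (hg : ∀ t c, |g t c| ≤ G) (T : ℕ) :
    γ * ∑ t ∈ Finset.range T, g t ⬝ᵥ (expGradIterate γ g t - u)
      ≤ Real.log (Fintype.card ι) + T * (γ ^ 2 * G ^ 2 / 2) := by
  set w := expGradIterate γ g
  have htelescope : γ * ∑ t ∈ Finset.range T, g t ⬝ᵥ (w t - u)
      ≤ ∑ c, u c * Real.log (w T c) - ∑ c, u c * Real.log (w 0 c)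
        + T * (γ ^ 2 * G ^ 2 / 2) := by
    induction T with
    | zero => simp
    | succ T ih =>
      have hstep : γ * (g T ⬝ᵥ (w T - u)) ≤ ∑ c, u c * Real.log (w (T + 1) c)
          - ∑ c, u c * Real.log (w T c) + γ ^ 2 * G ^ 2 / 2 :=
        mul_dotProduct_sub_le_expGradStep (expGradIterate_pos γ g T)
          (expGradIterate_mem_stdSimplex γ g T).2 hu.2 (hg T)
      rw [Finset.sum_range_succ, mul_add]
      push_cast
      linarith
  have hfinal : ∑ c, u c * Real.log (w T c) ≤ 0 := by
    have hw := expGradIterate_mem_stdSimplex γ g T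
    exact Finset.sum_nonpos fun c _ => mul_nonpos_of_nonneg_of_nonpos (hu.1 c)
      (Real.log_nonpos (hw.1 c) (hw.2 ▸ Finset.single_le_sum (fun c _ => hw.1 c)
        (Finset.mem_univ c)))
  have hinitial : ∑ c, u c * Real.log (w 0 c) = -Real.log (Fintype.card ι) := by
    simp only [w, expGradIterate, one_div, Real.log_inv, ← Finset.sum_mul, hu.2, one_mul]
  linarith

end ExponentiatedGradient

/-! ### Logistic regression -/

theorem exp_neg_abs_div_four_le_deriv_sigmoid (x : ℝ) :
    Real.exp (-|x|) / 4 ≤ deriv Real.sigmoid x := by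
  have hderiv : deriv Real.sigmoid x = 1 / ((1 + Real.exp (-x)) * (1 + Real.exp x)) := by
    simp only [Real.deriv_sigmoid]
    rw [← Real.sigmoid_neg, Real.sigmoid_def, Real.sigmoid_def, neg_neg, ← mul_inv, one_div]
  have hinv : Real.exp (-x) * Real.exp x = 1 := by rw [← Real.exp_add]; simp
  rw [hderiv, Real.exp_neg, ← one_div, div_div]
  refine one_div_le_one_div_of_le (by positivity) ?_
  have h₁ : Real.exp x ≤ Real.exp |x| := Real.exp_le_exp.2 (le_abs_self x)
  have h₂ : Real.exp (-x) ≤ Real.exp |x| := Real.exp_le_exp.2 (neg_le_abs x)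
  have h₃ : 1 ≤ Real.exp |x| := Real.one_le_exp (abs_nonneg x)
  linarith

theorem sigmoid_strongly_monotone {L a b : ℝ} (ha : |a| ≤ L) (hb : |b| ≤ L) :
    Real.exp (-L) / 4 * (b - a) ^ 2 ≤ (Real.sigmoid b - Real.sigmoid a) * (b - a) := by
  have hderiv : ∀ x ∈ interior (Set.Icc (-L) L), Real.exp (-L) / 4 ≤ deriv Real.sigmoid x :=
    fun x hx => le_trans (by gcongr; exact abs_le.2 (Set.mem_Icc.1 (interior_subset hx)))
      (exp_neg_abs_div_four_le_deriv_sigmoid x)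
  wlog hab : a ≤ b generalizing a b
  · linarith [this hb ha (le_of_not_ge hab)]
  have hslope : Real.exp (-L) / 4 * (b - a) ≤ Real.sigmoid b - Real.sigmoid a :=
    (convex_Icc (-L) L).mul_sub_le_image_sub_of_le_deriv continuous_sigmoid.continuousOn
      differentiable_sigmoid.differentiableOn hderiv a (abs_le.1 ha) b (abs_le.1 hb) hab
  nlinarith

theorem abs_dotProduct_le_sum_abs_mul {ι : Type*} [Fintype ι] {a b : ι → ℝ} {B : ℝ}
    (hb : ∀ j, |b j| ≤ B) : |a ⬝ᵥ b| ≤ (∑ j, |a j|) * B := by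
  rw [Finset.sum_mul]
  refine (Finset.abs_sum_le_sum_abs _ _).trans (Finset.sum_le_sum fun j _ => ?_)
  rw [abs_mul]
  gcongr
  exact hb j

section LogisticRegression

variable {ι S : Type*} [Fintype S]

/-- The second moment matrix of data points `x m` with weights `p m`; both the empirical and the
true second moments are of this form. -/
def secondMoment (p : S → ℝ) (x : S → ι → ℝ) : Matrix ι ι ℝ := fun j k =>
  ∑ m, p m * (x m j * x m k)

variable [Fintype ι]

/-- The gradient at `v` of the logistic loss of data points `x m` with labels `y m = ±1` and
weights `p m`; both the empirical and the expected loss are of this form. -/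
noncomputable def logisticGradient (p : S → ℝ) (x : S → ι → ℝ) (y : S → ℝ) (v : ι → ℝ) : ι → ℝ :=
  fun j => ∑ m, p m * ((Real.sigmoid (v ⬝ᵥ x m) - (y m + 1) / 2) * x m j)

theorem dotProduct_secondMoment_mulVec (p : S → ℝ) (x : S → ι → ℝ) (a : ι → ℝ) :
    a ⬝ᵥ secondMoment p x *ᵥ a = ∑ m, p m * (a ⬝ᵥ x m) ^ 2 := by
  simp only [dotProduct, Matrix.mulVec, secondMoment, sq, Finset.sum_mul, Finset.mul_sum]
  simp only [Finset.sum_comm (γ := S)]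
  exact Finset.sum_congr rfl fun m _ => Finset.sum_congr rfl fun j _ =>
    Finset.sum_congr rfl fun k _ => by ring

theorem dotProduct_logisticGradient (p : S → ℝ) (x : S → ι → ℝ) (y : S → ℝ) (v a : ι → ℝ) :
    a ⬝ᵥ logisticGradient p x y v
      = ∑ m, p m * ((Real.sigmoid (v ⬝ᵥ x m) - (y m + 1) / 2) * (a ⬝ᵥ x m)) := by
  simp only [logisticGradient, dotProduct.eq_1 a, Finset.mul_sum]
  rw [Finset.sum_comm]
  exact Finset.sum_congr rfl fun m _ => Finset.sum_congr rfl fun j _ => by ring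

theorem abs_sigmoid_sub_half_le_one (u : ℝ) {y : ℝ} (hy : |y| ≤ 1) :
    |Real.sigmoid u - (y + 1) / 2| ≤ 1 := by
  have h₀ := Real.sigmoid_pos u
  have h₁ := Real.sigmoid_lt_one u
  obtain ⟨hy₀, hy₁⟩ := abs_le.1 hy
  exact abs_le.2 ⟨by linarith, by linarith⟩

theorem abs_logisticGradient_le_one {p : S → ℝ} (hp : ∀ m, 0 ≤ p m) (hp₁ : ∑ m, p m ≤ 1)
    {x : S → ι → ℝ} {y : S → ℝ} (hx : ∀ m j, |x m j| ≤ 1) (hy : ∀ m, |y m| ≤ 1) (v : ι → ℝ)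
    (j : ι) : |logisticGradient p x y v j| ≤ 1 := by
  calc |logisticGradient p x y v j|
      ≤ ∑ m, |p m * ((Real.sigmoid (v ⬝ᵥ x m) - (y m + 1) / 2) * x m j)| :=
        Finset.abs_sum_le_sum_abs _ _
    _ ≤ ∑ m, p m := Finset.sum_le_sum fun m _ => by
        rw [abs_mul, abs_mul, abs_of_nonneg (hp m)]
        exact mul_le_of_le_one_right (hp m)
          (mul_le_one₀ (abs_sigmoid_sub_half_le_one _ (hy m)) (abs_nonneg _) (hx m j))
    _ ≤ 1 := hp₁

theorem abs_dotProduct_mulVec_le {M : Matrix ι ι ℝ} {h : ℝ} (hM : ∀ j k, |M j k| ≤ h)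
    (a : ι → ℝ) : |a ⬝ᵥ M *ᵥ a| ≤ (∑ j, |a j|) ^ 2 * h := by
  have hrow : ∀ j, |(M *ᵥ a) j| ≤ (∑ k, |a k|) * h := fun j => by
    rw [Matrix.mulVec, dotProduct_comm]
    exact abs_dotProduct_le_sum_abs_mul (hM j)
  exact (abs_dotProduct_le_sum_abs_mul hrow).trans_eq (by ring)

variable {W : ℝ} {p : S → ℝ} {x : S → ι → ℝ} {y : S → ℝ} {v b : ι → ℝ}

theorem logisticGradient_strongly_monotone (hp : ∀ m, 0 ≤ p m) (hx : ∀ m j, |x m j| ≤ 1)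
    (hv : ∑ j, |v j| ≤ W) (hb : ∑ j, |b j| ≤ W) :
    Real.exp (-W) / 4 * ((b - v) ⬝ᵥ secondMoment p x *ᵥ (b - v))
      ≤ (b - v) ⬝ᵥ logisticGradient p x y b - (b - v) ⬝ᵥ logisticGradient p x y v := by
  have hbound : ∀ a : ι → ℝ, ∑ j, |a j| ≤ W → ∀ m, |a ⬝ᵥ x m| ≤ W := fun a ha m =>
    (abs_dotProduct_le_sum_abs_mul (hx m)).trans (by rwa [mul_one])
  rw [dotProduct_secondMoment_mulVec, dotProduct_logisticGradient, dotProduct_logisticGradient,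
    ← Finset.sum_sub_distrib, Finset.mul_sum]
  refine Finset.sum_le_sum fun m _ => ?_
  have hmono := mul_le_mul_of_nonneg_left
    (sigmoid_strongly_monotone (hbound v hv m) (hbound b hb m)) (hp m)
  rw [sub_dotProduct]
  linarith

/-- This is strong monotonicity of the gradient, after replacing the gradient at `v` by zero and
the second moments by `M` at a cost proportional to `h`. -/
theorem exp_mul_dotProduct_mulVec_le (hp : ∀ m, 0 ≤ p m) (hx : ∀ m j, |x m j| ≤ 1)
    (hv : ∑ j, |v j| ≤ W) (hb : ∑ j, |b j| ≤ W) {h : ℝ} (hh : 0 ≤ h)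
    (hgrad : ∀ j, |logisticGradient p x y v j| ≤ h) {M : Matrix ι ι ℝ}
    (hM : ∀ j k, |secondMoment p x j k - M j k| ≤ h) :
    Real.exp (-W) / 4 * ((b - v) ⬝ᵥ M *ᵥ (b - v))
      ≤ (b - v) ⬝ᵥ logisticGradient p x y b + (2 * W * h + Real.exp (-W) * W ^ 2 * h) := by
  have hnorm : ∑ j, |(b - v) j| ≤ 2 * W :=
    calc ∑ j, |(b - v) j| ≤ ∑ j, (|b j| + |v j|) := Finset.sum_le_sum fun j _ => abs_sub _ _
      _ ≤ 2 * W := by rw [Finset.sum_add_distrib]; linarith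
  have hlinear : -(2 * W * h) ≤ (b - v) ⬝ᵥ logisticGradient p x y v :=
    (abs_le.1 ((abs_dotProduct_le_sum_abs_mul hgrad).trans (by gcongr))).1
  have hquadratic : (b - v) ⬝ᵥ M *ᵥ (b - v)
      ≤ (b - v) ⬝ᵥ secondMoment p x *ᵥ (b - v) + (2 * W) ^ 2 * h := by
    have hdiff := (abs_le.1 ((abs_dotProduct_mulVec_le (M := secondMoment p x - M) hM
      (b - v)).trans (by gcongr : _ ≤ (2 * W) ^ 2 * h))).1
    rw [Matrix.sub_mulVec, dotProduct_sub] at hdiff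
    linarith
  have hmono := logisticGradient_strongly_monotone (y := y) hp hx hv hb
  have hscaled := mul_le_mul_of_nonneg_left hquadratic (by positivity : 0 ≤ Real.exp (-W) / 4)
  linarith

end LogisticRegression

/-! ### Mirror descent on the lifted simplex -/

section MirrorDescent

variable {n N T : ℕ}

/-- The vector of the `ℓ₁` ball of radius `W` represented by a point of the lifted simplex. -/
def unlift (W : ℝ) (w : LiftedCoord n → ℝ) : Fin n → ℝ := fun j =>
  (w (.inl (.inl j)) - w (.inl (.inr j))) * W

theorem unlift_sub (W : ℝ) (w u : LiftedCoord n → ℝ) :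
    unlift W (w - u) = unlift W w - unlift W u := by
  funext j
  simp only [unlift, Pi.sub_apply]
  ring

theorem liftSample_dotProduct (W : ℝ) (x : Fin n → ℝ) (w : LiftedCoord n → ℝ) :
    liftSample W x ⬝ᵥ w = unlift W w ⬝ᵥ x := by
  simp only [dotProduct, Fintype.sum_sum_type, liftSample, Sum.elim_inl, Sum.elim_inr, zero_mul,
    Finset.sum_const_zero, add_zero, ← Finset.sum_add_distrib, unlift]
  exact Finset.sum_congr rfl fun j _ => by ring

theorem abs_liftSample_le {W : ℝ} (hW : 0 ≤ W) {x : Fin n → ℝ} (hx : ∀ j, |x j| ≤ 1)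
    (c : LiftedCoord n) : |liftSample W x c| ≤ W := by
  have hle : ∀ j, |x j| * W ≤ W := fun j => mul_le_of_le_one_left hW (hx j)
  rcases c with (j | j) | _ <;>
    simp only [liftSample, Sum.elim_inl, Sum.elim_inr, abs_mul, abs_neg, abs_of_nonneg hW, abs_zero]
  exacts [hle j, hle j, hW]

theorem sum_abs_unlift_le {W : ℝ} (hW : 0 ≤ W) {w : LiftedCoord n → ℝ}
    (hw : w ∈ stdSimplex ℝ (LiftedCoord n)) : ∑ j, |unlift W w j| ≤ W := by
  have hcoord : ∀ j, |unlift W w j| ≤ (w (.inl (.inl j)) + w (.inl (.inr j))) * W := fun j => by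
    rw [unlift, abs_mul, abs_of_nonneg hW]
    gcongr
    exact (abs_sub _ _).trans_eq (by rw [abs_of_nonneg (hw.1 _), abs_of_nonneg (hw.1 _)])
  have hmass : ∑ j, (w (.inl (.inl j)) + w (.inl (.inr j))) ≤ 1 := by
    rw [← hw.2, Fintype.sum_sum_type, Fintype.sum_sum_type, Finset.sum_add_distrib]
    exact le_add_of_nonneg_right (Finset.sum_nonneg fun c _ => hw.1 _)
  calc ∑ j, |unlift W w j| ≤ (∑ j, (w (.inl (.inl j)) + w (.inl (.inr j)))) * W := by
        rw [Finset.sum_mul]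
        exact Finset.sum_le_sum fun j _ => hcoord j
    _ ≤ W := mul_le_of_le_one_left hW hmass

theorem exists_mem_stdSimplex_unlift_eq {W : ℝ} (hW : 0 < W) {v : Fin n → ℝ}
    (hv : ∑ j, |v j| ≤ W) : ∃ u ∈ stdSimplex ℝ (LiftedCoord n), unlift W u = v := by
  refine ⟨Sum.elim (Sum.elim (fun j => (v j)⁺ / W) (fun j => (v j)⁻ / W))
    (fun _ => 1 - (∑ j, |v j|) / W), ⟨?_, ?_⟩, ?_⟩
  · rintro ((j | j) | _)
    · exact div_nonneg (posPart_nonneg _) hW.le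
    · exact div_nonneg (negPart_nonneg _) hW.le
    · exact sub_nonneg.2 ((div_le_one hW).2 hv)
  · simp only [Fintype.sum_sum_type, Sum.elim_inl, Sum.elim_inr, Finset.univ_unique,
      Finset.sum_singleton, ← Finset.sum_add_distrib, ← add_div, posPart_add_negPart,
      ← Finset.sum_div]
    ring
  · funext j
    simp only [unlift, Sum.elim_inl, Sum.elim_inr]
    rw [← sub_div, div_mul_cancel₀ _ hW.ne', posPart_sub_negPart]

theorem mdGradient_eq_liftSample (W : ℝ) (x : Fin N → Fin n → ℝ) (y : Fin N → ℝ)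
    (w : LiftedCoord n → ℝ) : mdGradient W x y w
      = liftSample W (logisticGradient (fun _ => 1 / (N : ℝ)) x y (unlift W w)) := by
  have hlift : ∀ m, ∑ c, w c * liftSample W (x m) c = unlift W w ⬝ᵥ x m := fun m => by
    rw [← liftSample_dotProduct, dotProduct_comm, dotProduct]
  funext c
  simp only [mdGradient, hlift]
  rcases c with (j | j) | _ <;>
    simp only [liftSample, Sum.elim_inl, Sum.elim_inr, logisticGradient, ← Finset.mul_sum,
      mul_zero, Finset.sum_const_zero, mul_assoc, Finset.sum_mul, neg_mul, mul_neg,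
      Finset.sum_neg_distrib]

theorem mdUpdate_eq_expGradStep {w : LiftedCoord n → ℝ} (hw : ∀ c, 0 < w c) (γ : ℝ)
    (g : LiftedCoord n → ℝ) : mdUpdate γ g w = expGradStep γ g w := by
  funext c
  simp only [mdUpdate, expGradStep, abs_of_pos (mul_pos (hw _) (Real.exp_pos _))]

theorem card_liftedCoord : (Fintype.card (LiftedCoord n) : ℝ) = 2 * n + 1 := by
  simp [two_mul]

theorem mdIterate_eq_expGradIterate (W : ℝ) (T : ℕ) (x : Fin N → Fin n → ℝ) (y : Fin N → ℝ)
    (t : ℕ) : mdIterate W T x y t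
      = expGradIterate (mdStepSize n W T) (fun s => mdGradient W x y (mdIterate W T x y s)) t := by
  induction t with
  | zero => simp only [mdIterate, expGradIterate, card_liftedCoord]
  | succ t ih =>
    rw [mdIterate, mdUpdate_eq_expGradStep (ih ▸ expGradIterate_pos _ _ t), expGradIterate, ← ih]

theorem mdIterate_mem_stdSimplex (W : ℝ) (T : ℕ) (x : Fin N → Fin n → ℝ) (y : Fin N → ℝ)
    (t : ℕ) : mdIterate W T x y t ∈ stdSimplex ℝ (LiftedCoord n) :=
  mdIterate_eq_expGradIterate W T x y t ▸ expGradIterate_mem_stdSimplex _ _ t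

theorem le_of_mdStepSize_mul_le {W : ℝ} (hW : 0 < W) (hn : 0 < n) (hT : 0 < T) {R : ℝ}
    (hR : mdStepSize n W T * R ≤ Real.log (2 * n + 1)
      + T * (mdStepSize n W T ^ 2 * W ^ 2 / 2)) :
    R ≤ T * (5 / 4 * W * √(2 * Real.log (2 * n + 1) / T)) := by
  have hT' : (0 : ℝ) < T := Nat.cast_pos.2 hT
  have hlog : 0 < Real.log (2 * n + 1) :=
    Real.log_pos (lt_add_of_pos_left 1 (mul_pos two_pos (Nat.cast_pos.2 hn)))
  rw [mdStepSize] at hR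
  set r := √(2 * Real.log (2 * n + 1) / T) with hr
  have hrpos : 0 < r := Real.sqrt_pos.2 (by positivity)
  have hlog_eq : Real.log (2 * n + 1) = T * r ^ 2 / 2 := by
    rw [hr, Real.sq_sqrt (by positivity)]
    field_simp
  rw [hlog_eq] at hR
  refine le_of_mul_le_mul_left (hR.trans_eq ?_) (by positivity : 0 < 1 / (2 * W) * r)
  field_simp
  ring

variable {W : ℝ} {x : Fin N → Fin n → ℝ} {y : Fin N → ℝ}

theorem sum_unlift_sub_dotProduct_logisticGradient_le (hW : 0 < W) (hn : 0 < n) (hT : 0 < T)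
    (hx : ∀ m j, |x m j| ≤ 1) (hy : ∀ m, |y m| ≤ 1) {v : Fin n → ℝ} (hv : ∑ j, |v j| ≤ W) :
    ∑ t ∈ Finset.range T, (unlift W (mdIterate W T x y t) - v) ⬝ᵥ
        logisticGradient (fun _ => 1 / (N : ℝ)) x y (unlift W (mdIterate W T x y t))
      ≤ T * (5 / 4 * W * √(2 * Real.log (2 * n + 1) / T)) := by
  obtain ⟨u, hu, rfl⟩ := exists_mem_stdSimplex_unlift_eq hW hv
  have hbound : ∀ t c, |mdGradient W x y (mdIterate W T x y t) c| ≤ W := fun t => by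
    rw [mdGradient_eq_liftSample]
    exact abs_liftSample_le hW.le
      (abs_logisticGradient_le_one (fun _ => by positivity) (by simpa using mul_inv_le_one) hx hy _)
  have hregret := mul_sum_dotProduct_sub_le_expGradIterate (γ := mdStepSize n W T) hu hbound T
  simp only [← mdIterate_eq_expGradIterate, card_liftedCoord] at hregret
  refine le_of_mdStepSize_mul_le hW hn hT (le_trans (le_of_eq ?_) hregret)
  simp only [mdGradient_eq_liftSample, liftSample_dotProduct, unlift_sub]

theorem mirrorDescent_eq_sum_unlift (W : ℝ) (T : ℕ) (x : Fin N → Fin n → ℝ) (y : Fin N → ℝ)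
    (j : Fin n) : mirrorDescent W T x y j
      = (∑ t ∈ Finset.range T, unlift W (mdIterate W T x y t) j) / T := by
  simp only [mirrorDescent, mdAverage, unlift, ← Finset.sum_mul, Finset.sum_sub_distrib]
  ring

theorem card_mul_sq_mirrorDescent_sub_le (hT : 0 < T) (W : ℝ) (x : Fin N → Fin n → ℝ)
    (y : Fin N → ℝ) (j : Fin n) (a : ℝ) : T * (mirrorDescent W T x y j - a) ^ 2
      ≤ ∑ t ∈ Finset.range T, (unlift W (mdIterate W T x y t) j - a) ^ 2 := by
  have hT' : (0 : ℝ) < T := Nat.cast_pos.2 hT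
  set f := fun t => unlift W (mdIterate W T x y t) j - a with hf
  have hmean : mirrorDescent W T x y j - a = (∑ t ∈ Finset.range T, f t) / T := by
    simp only [hf, mirrorDescent_eq_sum_unlift, Finset.sum_sub_distrib, Finset.sum_const,
      Finset.card_range, nsmul_eq_mul]
    field_simp
  have hcauchy := sq_sum_le_card_mul_sum_sq (s := Finset.range T) (f := f)
  rw [Finset.card_range] at hcauchy
  calc T * (mirrorDescent W T x y j - a) ^ 2 = (∑ t ∈ Finset.range T, f t) ^ 2 / T := by
        rw [hmean]
        field_simp
    _ ≤ ∑ t ∈ Finset.range T, f t ^ 2 := (div_le_iff₀' hT').2 hcauchy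

theorem exp_mul_sq_mirrorDescent_sub_le (hW : 0 < W) (hT : 0 < T)
    (hx : ∀ m j, |x m j| ≤ 1) (hy : ∀ m, |y m| ≤ 1) {v : Fin n → ℝ} (hv : ∑ j, |v j| ≤ W)
    {h : ℝ} (hh : 0 ≤ h) (hgrad : ∀ j, |logisticGradient (fun _ => 1 / (N : ℝ)) x y v j| ≤ h)
    {M : Matrix (Fin n) (Fin n) ℝ}
    (hM : ∀ j k, |secondMoment (fun _ => 1 / (N : ℝ)) x j k - M j k| ≤ h)
    {j : Fin n} {κ : ℝ} (hκ : 0 ≤ κ) (hκM : ∀ a : Fin n → ℝ, κ * a j ^ 2 ≤ a ⬝ᵥ M *ᵥ a) :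
    Real.exp (-W) / 4 * κ * (mirrorDescent W T x y j - v j) ^ 2
      ≤ 5 / 4 * W * √(2 * Real.log (2 * n + 1) / T)
        + (2 * W * h + Real.exp (-W) * W ^ 2 * h) := by
  set b := fun t => unlift W (mdIterate W T x y t)
  have hstep : ∀ t, Real.exp (-W) / 4 * κ * (b t j - v j) ^ 2
      ≤ (b t - v) ⬝ᵥ logisticGradient (fun _ => 1 / (N : ℝ)) x y (b t)
        + (2 * W * h + Real.exp (-W) * W ^ 2 * h) := fun t => by
    refine le_trans ?_ (exp_mul_dotProduct_mulVec_le (fun _ => by positivity) hx hv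
      (sum_abs_unlift_le hW.le (mdIterate_mem_stdSimplex W T x y t)) hh hgrad hM)
    rw [mul_assoc]
    gcongr
    exact hκM (b t - v)
  have hregret := sum_unlift_sub_dotProduct_logisticGradient_le hW j.pos hT hx hy hv
  refine le_of_mul_le_mul_left ?_ (Nat.cast_pos.2 hT : (0 : ℝ) < T)
  calc T * (Real.exp (-W) / 4 * κ * (mirrorDescent W T x y j - v j) ^ 2)
      = Real.exp (-W) / 4 * κ * (T * (mirrorDescent W T x y j - v j) ^ 2) := by ring
    _ ≤ Real.exp (-W) / 4 * κ * ∑ t ∈ Finset.range T, (b t j - v j) ^ 2 := by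
        gcongr
        exact card_mul_sq_mirrorDescent_sub_le hT W x y j (v j)
    _ ≤ ∑ t ∈ Finset.range T, ((b t - v) ⬝ᵥ logisticGradient (fun _ => 1 / (N : ℝ)) x y (b t)
          + (2 * W * h + Real.exp (-W) * W ^ 2 * h)) := by
        rw [Finset.mul_sum]
        exact Finset.sum_le_sum fun t _ => hstep t
    _ ≤ _ := by
        rw [Finset.sum_add_distrib, Finset.sum_const, Finset.card_range, nsmul_eq_mul, mul_add]
        linarith

end MirrorDescent

/-! ### Empirical means of bounded functions -/

section Hoeffding

variable {Ω ι : Type*} [MeasurableSpace Ω] [Fintype ι] (μ : Measure Ω) [IsProbabilityMeasure μ]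
  {h : ℝ}

open ProbabilityTheory in
theorem measureReal_pi_le_sum_sub_integral_le {F : Ω → ℝ} (hFm : Measurable F)
    (hF : ∀ ω, |F ω| ≤ 1) (hh : 0 ≤ h) :
    (Measure.pi fun _ : ι => μ).real
      {z | Fintype.card ι * h ≤ ∑ m, (F (z m) - ∫ ω, F ω ∂μ)}
      ≤ Real.exp (-(Fintype.card ι * h ^ 2 / 2)) := by
  set E := ∫ ω, F ω ∂μ
  have hmean : ∀ m, ∫ z : ι → Ω, F (z m) ∂(Measure.pi fun _ => μ) = E := fun m =>
    integral_comp_eval (μ := fun _ : ι => μ) hFm.aestronglyMeasurable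
  have hsubgaussian : ∀ m ∈ Finset.univ, HasSubgaussianMGF (fun z : ι → Ω => F (z m) - E) 1
      (Measure.pi fun _ => μ) := fun m _ => by
    have hIcc := hasSubgaussianMGF_of_mem_Icc (μ := Measure.pi fun _ : ι => μ)
      (X := fun z => F (z m)) (a := -1) (b := 1) (hFm.comp (measurable_pi_apply m)).aemeasurable
      (Filter.Eventually.of_forall fun z => abs_le.1 (hF (z m)))
    rw [hmean m] at hIcc
    convert hIcc
    ext
    norm_num
  have hindep : iIndepFun (fun m (z : ι → Ω) => F (z m) - E) (Measure.pi fun _ => μ) :=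
    iIndepFun_pi (X := fun _ ω => F ω - E) fun _ => (hFm.sub_const E).aemeasurable
  refine (HasSubgaussianMGF.measure_sum_ge_le_of_iIndepFun hindep hsubgaussian
    (by positivity)).trans_eq ?_
  congr 1
  simp only [Finset.sum_const, Finset.card_univ, nsmul_eq_mul, mul_one, NNReal.coe_natCast]
  field_simp

theorem one_sub_le_measureReal_pi_forall_abs_sub_integral_le {α : Type*} [Fintype α] [Nonempty ι]
    {F : α → Ω → ℝ} (hFm : ∀ a, Measurable (F a)) (hF : ∀ a ω, |F a ω| ≤ 1) (hh : 0 ≤ h) :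
    1 - Fintype.card α * (2 * Real.exp (-(Fintype.card ι * h ^ 2 / 2)))
      ≤ (Measure.pi fun _ : ι => μ).real
        {z | ∀ a, |∑ m, 1 / (Fintype.card ι : ℝ) * F a (z m) - ∫ ω, F a ω ∂μ| ≤ h} := by
  set P := Measure.pi fun _ : ι => μ
  set good := {z : ι → Ω |
    ∀ a, |∑ m, 1 / (Fintype.card ι : ℝ) * F a (z m) - ∫ ω, F a ω ∂μ| ≤ h} with hgood
  have hcard : (0 : ℝ) < Fintype.card ι := Nat.cast_pos.2 Fintype.card_pos
  have hcover : goodᶜ ⊆ ⋃ a,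
      ({z : ι → Ω | Fintype.card ι * h ≤ ∑ m, (F a (z m) - ∫ ω, F a ω ∂μ)} ∪
        {z | Fintype.card ι * h ≤ ∑ m, (-F a (z m) - ∫ ω, -F a ω ∂μ)}) := by
    intro z hz
    simp only [hgood, Set.mem_compl_iff, Set.mem_ofPred_eq, not_forall, not_le,
      ← Finset.mul_sum] at hz
    obtain ⟨a, ha⟩ := hz
    rw [← mul_lt_mul_iff_right₀ hcard, ← abs_of_pos hcard, ← abs_mul, abs_of_pos hcard, mul_sub,
      ← mul_assoc, mul_one_div_cancel hcard.ne', one_mul] at ha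
    refine Set.mem_iUnion.2 ⟨a, (lt_abs.1 ha).imp (fun h => ?_) fun h => ?_⟩ <;>
      simp only [Set.mem_ofPred_eq, integral_neg, Finset.sum_sub_distrib, Finset.sum_neg_distrib,
        Finset.sum_const, Finset.card_univ, nsmul_eq_mul] <;>
      linarith
  have hbad : P.real goodᶜ
      ≤ Fintype.card α * (2 * Real.exp (-(Fintype.card ι * h ^ 2 / 2))) := by
    refine (measureReal_mono hcover).trans ((measureReal_iUnion_fintype_le _).trans ?_)
    refine (Finset.sum_le_card_nsmul _ _ _ fun a _ => ?_).trans_eq (nsmul_eq_mul _ _)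
    rw [two_mul]
    exact (measureReal_union_le _ _).trans (add_le_add
      (measureReal_pi_le_sum_sub_integral_le μ (hFm a) (hF a) hh)
      (measureReal_pi_le_sum_sub_integral_le μ (hFm a).neg
        (fun ω => (abs_neg _).trans_le (hF a ω)) hh))
  have htotal := measureReal_union_le (μ := P) good goodᶜ
  rw [Set.union_compl_self, probReal_univ] at htotal
  linarith

end Hoeffding

/-! ### Conditional laws in the Ising model -/

theorem spin_eq_one_or_neg_one (s : ℤˣ) : spin s = 1 ∨ spin s = -1 := by
  rcases Int.units_eq_one_or s with rfl | rfl <;> simp [spin]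

theorem abs_spin (s : ℤˣ) : |spin s| = 1 := by
  rcases spin_eq_one_or_neg_one s with h | h <;> simp [h]

theorem spin_neg (s : ℤˣ) : spin (-s) = -spin s := by
  simp [spin]

section Ising

variable {n : ℕ}

/-- The configuration with the spin at `i` flipped. -/
def flipSpin (i : Fin n) (z : Fin n → ℤˣ) : Fin n → ℤˣ :=
  Function.update z i (-z i)

theorem flipSpin_self (i : Fin n) (z : Fin n → ℤˣ) : flipSpin i z i = -z i := by
  simp [flipSpin]

theorem flipSpin_of_ne {i j : Fin n} (hj : j ≠ i) (z : Fin n → ℤˣ) :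
    flipSpin i z j = z j := by
  simp [flipSpin, hj]

theorem flipSpin_involutive (i : Fin n) : Function.Involutive (flipSpin i) := fun z => by
  simp [flipSpin]

theorem sum_comp_flipSpin (i : Fin n) (f : (Fin n → ℤˣ) → ℝ) :
    ∑ z, f (flipSpin i z) = ∑ z, f z :=
  Equiv.sum_comp (flipSpin_involutive i).toPerm f

theorem spin_comp_flipSpin (i : Fin n) (z : Fin n → ℤˣ) :
    spin ∘ flipSpin i z = spin ∘ z + Pi.single i (-2 * spin (z i)) := by
  funext j
  rcases eq_or_ne j i with rfl | hj
  · simp only [Function.comp_apply, flipSpin_self, spin_neg, Pi.add_apply, Pi.single_eq_same]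
    ring
  · simp [flipSpin_of_ne hj, hj]

theorem two_mul_sum_sum_Ioi {f : Fin n → Fin n → ℝ} (hsymm : ∀ i j, f i j = f j i)
    (hdiag : ∀ i, f i i = 0) :
    2 * ∑ i, ∑ j ∈ Finset.Ioi i, f i j = ∑ i, ∑ j, f i j := by
  calc 2 * ∑ i, ∑ j ∈ Finset.Ioi i, f i j = ∑ i, ∑ j ∈ Finset.Ioi i, (f j i + f i j) := by
        simp only [Finset.mul_sum, two_mul, hsymm]
    _ = ∑ i, ∑ j ∈ {i}ᶜ, f j i := Finset.sum_sum_Ioi_add_eq_sum_sum_off_diag f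
    _ = ∑ i, ∑ j, f i j := Finset.sum_congr rfl fun i _ => by
        rw [← Finset.sum_compl_add_sum {i}, Finset.sum_singleton, hdiag, add_zero]
        exact Finset.sum_congr rfl fun j _ => hsymm j i

variable {A : Matrix (Fin n) (Fin n) ℝ} {θ : Fin n → ℝ}

/-- The local field at the node `i`: half the log-odds of its spin given the other spins. -/
noncomputable def localField (A : Matrix (Fin n) (Fin n) ℝ) (θ : Fin n → ℝ) (i : Fin n)
    (z : Fin n → ℤˣ) : ℝ :=
  (A *ᵥ (spin ∘ z)) i + θ i

theorem localField_flipSpin (hdiag : ∀ i, A i i = 0) (i : Fin n) (z : Fin n → ℤˣ) :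
    localField A θ i (flipSpin i z) = localField A θ i z := by
  simp [localField, spin_comp_flipSpin, Matrix.mulVec_add, hdiag]

theorem sum_abs_add_abs_le_isingWidth (A : Matrix (Fin n) (Fin n) ℝ) (θ : Fin n → ℝ)
    (i : Fin n) : (∑ j, |A i j|) + |θ i| ≤ isingWidth A θ :=
  le_ciSup (f := fun i => (∑ j, |A i j|) + |θ i|) (Set.finite_range _).bddAbove i

theorem abs_localField_le (A : Matrix (Fin n) (Fin n) ℝ) (θ : Fin n → ℝ) (i : Fin n)
    (z : Fin n → ℤˣ) : |localField A θ i z| ≤ isingWidth A θ := by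
  have hrow : |(A *ᵥ (spin ∘ z)) i| ≤ (∑ j, |A i j|) * 1 :=
    abs_dotProduct_le_sum_abs_mul fun j => (abs_spin (z j)).le
  rw [mul_one] at hrow
  exact (abs_add_le _ _).trans ((add_le_add_left hrow _).trans
    (sum_abs_add_abs_le_isingWidth A θ i))

theorem isingWeight_eq_exp_dotProduct (hA : A.IsSymm) (hdiag : ∀ i, A i i = 0)
    (z : Fin n → ℤˣ) : isingWeight A θ z
      = Real.exp (spin ∘ z ⬝ᵥ A *ᵥ (spin ∘ z) / 2 + θ ⬝ᵥ spin ∘ z) := by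
  have hquadratic : 2 * ∑ i, ∑ j ∈ Finset.Ioi i, A i j * spin (z i) * spin (z j)
      = spin ∘ z ⬝ᵥ A *ᵥ (spin ∘ z) := by
    rw [two_mul_sum_sum_Ioi (fun i j => by rw [hA.apply i j]; ring) fun i => by simp [hdiag]]
    simp only [dotProduct, Matrix.mulVec, Finset.mul_sum, Function.comp_apply]
    exact Finset.sum_congr rfl fun i _ => Finset.sum_congr rfl fun j _ => by ring
  rw [isingWeight, ← hquadratic, mul_div_cancel_left₀ _ two_ne_zero]
  rfl

theorem isingWeight_flipSpin (hA : A.IsSymm) (hdiag : ∀ i, A i i = 0) (i : Fin n)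
    (z : Fin n → ℤˣ) : isingWeight A θ (flipSpin i z)
      = isingWeight A θ z * Real.exp (-2 * spin (z i) * localField A θ i z) := by
  have hcross : spin ∘ z ⬝ᵥ A.col i = (A *ᵥ (spin ∘ z)) i := by
    rw [show A.col i = A i from funext fun j => hA.apply i j, dotProduct_comm, Matrix.mulVec]
  rw [isingWeight_eq_exp_dotProduct hA hdiag, isingWeight_eq_exp_dotProduct hA hdiag,
    ← Real.exp_add, spin_comp_flipSpin]
  congr 1
  simp only [Matrix.mulVec_add, dotProduct_add, add_dotProduct, Matrix.mulVec_single,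
    single_dotProduct, dotProduct_single, dotProduct_smul, hcross, localField,
    Matrix.col_apply, hdiag, MulOpposite.smul_eq_mul_unop, MulOpposite.unop_op]
  ring

/-- The probability of a configuration, as a real number. -/
noncomputable def isingProb (A : Matrix (Fin n) (Fin n) ℝ) (θ : Fin n → ℝ) (z : Fin n → ℤˣ) : ℝ :=
  (isingPMF A θ z).toReal

theorem isingProb_eq_div (z : Fin n → ℤˣ) :
    isingProb A θ z = isingWeight A θ z / ∑ z', isingWeight A θ z' :=
  ENNReal.toReal_ofReal (div_nonneg (Real.exp_pos _).le
    (Finset.sum_nonneg fun _ _ => (Real.exp_pos _).le))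

theorem isingProb_nonneg (z : Fin n → ℤˣ) : 0 ≤ isingProb A θ z :=
  ENNReal.toReal_nonneg

theorem sum_isingProb (A : Matrix (Fin n) (Fin n) ℝ) (θ : Fin n → ℝ) :
    ∑ z, isingProb A θ z = 1 := by
  simp only [isingProb_eq_div, ← Finset.sum_div]
  exact div_self (Finset.sum_pos (fun z _ => Real.exp_pos _) Finset.univ_nonempty).ne'

theorem isingProb_flipSpin (hA : A.IsSymm) (hdiag : ∀ i, A i i = 0) (i : Fin n)
    (z : Fin n → ℤˣ) : isingProb A θ (flipSpin i z)
      = isingProb A θ z * Real.exp (-2 * spin (z i) * localField A θ i z) := by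
  rw [isingProb_eq_div, isingProb_eq_div, isingWeight_flipSpin hA hdiag]
  ring

theorem exp_neg_isingWidth_mul_isingProb_le (hA : A.IsSymm) (hdiag : ∀ i, A i i = 0) (i : Fin n)
    (z : Fin n → ℤˣ) :
    Real.exp (-2 * isingWidth A θ) * isingProb A θ z ≤ isingProb A θ (flipSpin i z) := by
  rw [isingProb_flipSpin hA hdiag, mul_comm]
  refine mul_le_mul_of_nonneg_left (Real.exp_le_exp.2 ?_) (isingProb_nonneg z)
  obtain ⟨h₁, h₂⟩ := abs_le.1 (abs_localField_le A θ i z)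
  rcases spin_eq_one_or_neg_one (z i) with h | h <;> rw [h] <;> linarith

end Ising

/-! ### Logistic regression of a node on the others -/

section NodeRegression

variable {n : ℕ} {A : Matrix (Fin n) (Fin n) ℝ} {θ : Fin n → ℝ}

/-- The true regression vector of the node `i`. As in `nodeFeature`, the slot `i` belongs to the
constant coordinate. -/
noncomputable def nodeWeights (A : Matrix (Fin n) (Fin n) ℝ) (θ : Fin n → ℝ) (i : Fin n) :
    Fin n → ℝ := fun j =>
  2 * if j = i then θ i else A i j

theorem nodeWeights_dotProduct_nodeFeature (hdiag : ∀ i, A i i = 0) (i : Fin n)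
    (z : Fin n → ℤˣ) : nodeWeights A θ i ⬝ᵥ nodeFeature i z = 2 * localField A θ i z := by
  have hterm : ∀ j, nodeWeights A θ i j * nodeFeature i z j
      = 2 * (A i j * spin (z j) + if j = i then θ i else 0) := fun j => by
    rcases eq_or_ne j i with rfl | hj
    · simp [nodeWeights, nodeFeature, hdiag]
    · simp [nodeWeights, nodeFeature, hj, mul_assoc]
  simp only [dotProduct, hterm, ← Finset.mul_sum, Finset.sum_add_distrib, Finset.sum_ite_eq',
    Finset.mem_univ, if_true]
  rfl

theorem sum_abs_nodeWeights_le (hdiag : ∀ i, A i i = 0) (i : Fin n) :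
    ∑ j, |nodeWeights A θ i j| ≤ 2 * isingWidth A θ := by
  have hterm : ∀ j, |nodeWeights A θ i j| = 2 * (|A i j| + if j = i then |θ i| else 0) :=
    fun j => by
      rcases eq_or_ne j i with rfl | hj
      · simp [nodeWeights, hdiag, abs_mul]
      · simp [nodeWeights, hj, abs_mul]
  simp only [hterm, ← Finset.mul_sum, Finset.sum_add_distrib, Finset.sum_ite_eq',
    Finset.mem_univ, if_true]
  exact mul_le_mul_of_nonneg_left (sum_abs_add_abs_le_isingWidth A θ i) zero_le_two

theorem abs_nodeFeature_le_one (i : Fin n) (z : Fin n → ℤˣ) (j : Fin n) :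
    |nodeFeature i z j| ≤ 1 := by
  rw [nodeFeature]
  split_ifs
  · exact abs_one.le
  · exact (abs_spin _).le

theorem nodeFeature_flipSpin_self (i : Fin n) (z : Fin n → ℤˣ) :
    nodeFeature i (flipSpin i z) = nodeFeature i z := by
  funext j
  rw [nodeFeature, nodeFeature]
  split_ifs with hj
  · rfl
  · rw [flipSpin_of_ne hj]

theorem nodeFeature_flipSpin_of_ne {i j : Fin n} (hj : j ≠ i) (z : Fin n → ℤˣ) :
    nodeFeature i (flipSpin j z) = nodeFeature i z + Pi.single j (-2 * spin (z j)) := by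
  funext k
  have hk := congrFun (spin_comp_flipSpin j z) k
  rcases eq_or_ne k i with rfl | hki
  · simp [nodeFeature, hj.symm]
  · simpa [nodeFeature, hki] using hk

theorem sigmoid_sub_add_exp_mul_sigmoid_sub_eq_zero {s : ℝ} (hs : s = 1 ∨ s = -1) (H : ℝ) :
    (Real.sigmoid (2 * H) - (s + 1) / 2)
      + Real.exp (-2 * s * H) * (Real.sigmoid (2 * H) - (-s + 1) / 2) = 0 := by
  have hexp : Real.exp (2 * H) * Real.exp (-(2 * H)) = 1 := by
    rw [← Real.exp_add, add_neg_cancel, Real.exp_zero]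
  rw [Real.sigmoid_def]
  rcases hs with rfl | rfl
  · rw [show -2 * 1 * H = -(2 * H) by ring]
    field_simp
    ring
  · rw [show -2 * -1 * H = 2 * H by ring]
    field_simp
    linear_combination -2 * hexp

theorem logisticGradient_isingProb_nodeWeights (hA : A.IsSymm) (hdiag : ∀ i, A i i = 0)
    (i : Fin n) : logisticGradient (isingProb A θ) (nodeFeature i) (fun z => spin (z i))
      (nodeWeights A θ i) = 0 := by
  funext j
  set f : (Fin n → ℤˣ) → ℝ := fun z => isingProb A θ z *
    ((Real.sigmoid (nodeWeights A θ i ⬝ᵥ nodeFeature i z) - (spin (z i) + 1) / 2)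
      * nodeFeature i z j) with hf
  have hpair : ∀ z, f z + f (flipSpin i z) = 0 := fun z => by
    have hscalar := sigmoid_sub_add_exp_mul_sigmoid_sub_eq_zero
      (spin_eq_one_or_neg_one (z i)) (localField A θ i z)
    simp only [hf, nodeWeights_dotProduct_nodeFeature hdiag, isingProb_flipSpin hA hdiag,
      localField_flipSpin hdiag, nodeFeature_flipSpin_self, flipSpin_self, spin_neg]
    linear_combination isingProb A θ z * nodeFeature i z j * hscalar
  have htwice : ∑ z, f z + ∑ z, f z = 0 := by
    nth_rw 2 [← sum_comp_flipSpin i f]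
    rw [← Finset.sum_add_distrib]
    exact Finset.sum_eq_zero fun z _ => hpair z
  exact add_self_eq_zero.1 htwice

theorem isingWidth_nonneg (A : Matrix (Fin n) (Fin n) ℝ) (θ : Fin n → ℝ) :
    0 ≤ isingWidth A θ :=
  Real.iSup_nonneg fun _ => by positivity

/-- Flipping the spin at `j` changes `a ⬝ᵥ nodeFeature i z` by `± 2 * a j`, and both configurations
have comparable probabilities. -/
theorem exp_mul_sq_le_dotProduct_secondMoment_nodeFeature (hA : A.IsSymm)
    (hdiag : ∀ i, A i i = 0) {i j : Fin n} (hj : j ≠ i) (a : Fin n → ℝ) :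
    Real.exp (-2 * isingWidth A θ) * a j ^ 2
      ≤ a ⬝ᵥ secondMoment (isingProb A θ) (nodeFeature i) *ᵥ a := by
  rw [dotProduct_secondMoment_mulVec]
  set κ := Real.exp (-2 * isingWidth A θ)
  set f : (Fin n → ℤˣ) → ℝ := fun z => isingProb A θ z * (a ⬝ᵥ nodeFeature i z) ^ 2
  have hκ : κ ≤ 1 := Real.exp_le_one_iff.2 (by linarith [isingWidth_nonneg A θ])
  have hpair : ∀ z, isingProb A θ z * (2 * κ * a j ^ 2) ≤ f z + f (flipSpin j z) := fun z => by
    set D := a ⬝ᵥ nodeFeature i z with hD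
    have hflip : a ⬝ᵥ nodeFeature i (flipSpin j z) = D - 2 * (a j * spin (z j)) := by
      rw [nodeFeature_flipSpin_of_ne hj, dotProduct_add, dotProduct_single]
      ring
    have hspin : spin (z j) ^ 2 = 1 := by rw [← sq_abs, abs_spin, one_pow]
    have hsquares : 2 * a j ^ 2 ≤ D ^ 2 + (D - 2 * (a j * spin (z j))) ^ 2 := by
      linear_combination 2 * sq_nonneg (D - a j * spin (z j)) - 2 * a j ^ 2 * hspin
    calc isingProb A θ z * (2 * κ * a j ^ 2)
        = κ * isingProb A θ z * (2 * a j ^ 2) := by ring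
      _ ≤ κ * isingProb A θ z * (D ^ 2 + (D - 2 * (a j * spin (z j))) ^ 2) :=
        mul_le_mul_of_nonneg_left hsquares (mul_nonneg (Real.exp_pos _).le (isingProb_nonneg z))
      _ = κ * isingProb A θ z * D ^ 2
          + κ * isingProb A θ z * (D - 2 * (a j * spin (z j))) ^ 2 := mul_add _ _ _
      _ ≤ f z + f (flipSpin j z) := by
        simp only [f, hflip, ← hD]
        exact add_le_add
          (mul_le_mul_of_nonneg_right (mul_le_of_le_one_left (isingProb_nonneg z) hκ)
            (sq_nonneg _))
          (mul_le_mul_of_nonneg_right (exp_neg_isingWidth_mul_isingProb_le hA hdiag j z)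
            (sq_nonneg _))
  have hsum := Finset.sum_le_sum fun z (_ : z ∈ Finset.univ) => hpair z
  rw [← Finset.sum_mul, sum_isingProb, Finset.sum_add_distrib, sum_comp_flipSpin] at hsum
  linarith

end NodeRegression

/-! ### Accuracy of the estimated weights -/

section Accuracy

variable {n N T : ℕ} {A : Matrix (Fin n) (Fin n) ℝ} {θ : Fin n → ℝ} {lam ρ ε h : ℝ}

/-- The functions of one sample whose empirical means control the estimation error: the
coordinates of the gradients of all node regressions at the true regression vectors, and the
products of two coordinates of the feature vectors. -/
noncomputable def sampleStatistic (A : Matrix (Fin n) (Fin n) ℝ) (θ : Fin n → ℝ) :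
    (Fin n × Fin n) ⊕ (Fin n × Fin n × Fin n) → (Fin n → ℤˣ) → ℝ
  | .inl (i, j), z =>
    (Real.sigmoid (nodeWeights A θ i ⬝ᵥ nodeFeature i z) - (spin (z i) + 1) / 2)
      * nodeFeature i z j
  | .inr (i, j, k), z => nodeFeature i z j * nodeFeature i z k

theorem abs_sampleStatistic_le_one (A : Matrix (Fin n) (Fin n) ℝ) (θ : Fin n → ℝ)
    (a : (Fin n × Fin n) ⊕ (Fin n × Fin n × Fin n)) (z : Fin n → ℤˣ) :
    |sampleStatistic A θ a z| ≤ 1 := by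
  rcases a with ⟨i, j⟩ | ⟨i, j, k⟩ <;> rw [sampleStatistic, abs_mul]
  · exact mul_le_one₀ (abs_sigmoid_sub_half_le_one _ (abs_spin _).le) (abs_nonneg _)
      (abs_nodeFeature_le_one i z j)
  · exact mul_le_one₀ (abs_nodeFeature_le_one i z j) (abs_nonneg _)
      (abs_nodeFeature_le_one i z k)

/-- The sample sequences for which the empirical means of all `sampleStatistic`s are within `h` of
their expectations. -/
def concentratedSamples (A : Matrix (Fin n) (Fin n) ℝ) (θ : Fin n → ℝ) (N : ℕ) (h : ℝ) :
    Set (Fin N → Fin n → ℤˣ) :=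
  {z | ∀ a, |∑ m, 1 / (N : ℝ) * sampleStatistic A θ a (z m)
    - ∑ w, isingProb A θ w * sampleStatistic A θ a w| ≤ h}

theorem exp_mul_sq_sub_isingEstimate_le (hA : A.IsSymm) (hdiag : ∀ i, A i i = 0)
    (hwidth : isingWidth A θ ≤ lam) (hlam : 0 < lam) (hT : 0 < T) (hh : 0 ≤ h)
    {z : Fin N → Fin n → ℤˣ} (hz : z ∈ concentratedSamples A θ N h) {i j : Fin n}
    (hj : j ≠ i) :
    Real.exp (-(4 * lam)) * (A i j - isingEstimate lam T z i j) ^ 2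
      ≤ 5 / 2 * lam * √(2 * Real.log (2 * n + 1) / T)
        + (4 * lam * h + 4 * Real.exp (-(2 * lam)) * lam ^ 2 * h) := by
  have hgrad : ∀ k, |logisticGradient (fun _ => 1 / (N : ℝ)) (fun m => nodeFeature i (z m))
      (fun m => spin (z m i)) (nodeWeights A θ i) k| ≤ h := fun k => by
    have hmean := congrFun (logisticGradient_isingProb_nodeWeights (θ := θ) hA hdiag i) k
    have hconc := hz (.inl (i, k))
    rw [← sub_zero (logisticGradient _ _ _ _ k), ← Pi.zero_apply (M := fun _ => ℝ) k, ← hmean]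
    exact hconc
  have hmoment : ∀ a : Fin n → ℝ, Real.exp (-2 * lam) * a j ^ 2
      ≤ a ⬝ᵥ secondMoment (isingProb A θ) (nodeFeature i) *ᵥ a := fun a =>
    (mul_le_mul_of_nonneg_right (Real.exp_le_exp.2 (by linarith)) (sq_nonneg _)).trans
      (exp_mul_sq_le_dotProduct_secondMoment_nodeFeature hA hdiag hj a)
  have herror := exp_mul_sq_mirrorDescent_sub_le (W := 2 * lam) (by positivity) hT
    (fun m => abs_nodeFeature_le_one i (z m)) (fun m => (abs_spin (z m i)).le)
    ((sum_abs_nodeWeights_le hdiag i).trans (by linarith)) hh hgrad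
    (fun k l => hz (.inr (i, k, l))) (Real.exp_pos _).le hmoment
  have hexp : Real.exp (-(4 * lam)) = Real.exp (-(2 * lam)) * Real.exp (-2 * lam) := by
    rw [← Real.exp_add]
    ring_nf
  rw [nodeWeights, if_neg hj] at herror
  rw [isingEstimate, if_neg hj, hexp]
  linear_combination herror

theorem one_sub_le_isingSamples_concentratedSamples (hN : 0 < N) (hh : 0 ≤ h) :
    1 - ((n : ℝ) ^ 2 + n ^ 3) * (2 * Real.exp (-(N * h ^ 2 / 2)))
      ≤ (isingSamples A θ N).real (concentratedSamples A θ N h) := by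
  have : Nonempty (Fin N) := ⟨⟨0, hN⟩⟩
  have hconc := one_sub_le_measureReal_pi_forall_abs_sub_integral_le (ι := Fin N)
    (isingPMF A θ).toMeasure (fun _ => Measurable.of_discrete) (abs_sampleStatistic_le_one A θ) hh
  simp only [PMF.integral_eq_sum, smul_eq_mul, Fintype.card_fin, Fintype.card_sum,
    Fintype.card_prod, Nat.cast_add, Nat.cast_mul] at hconc
  rw [sq, pow_three]
  exact hconc

theorem abs_sub_isingEstimate_le (hA : A.IsSymm) (hdiag : ∀ i, A i i = 0)
    (hwidth : isingWidth A θ ≤ lam) (hlam : 0 < lam) (hε : 0 ≤ ε) (hT : 0 < T) (hh : 0 ≤ h)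
    (hopt : lam * √(2 * Real.log (2 * n + 1) / T) ≤ 2 / 25 * (ε ^ 2 * Real.exp (-(6 * lam))))
    (hstat : lam * h ≤ 1 / 10 * (ε ^ 2 * Real.exp (-(6 * lam))))
    {z : Fin N → Fin n → ℤˣ} (hz : z ∈ concentratedSamples A θ N h) (i j : Fin n) :
    |A i j - isingEstimate lam T z i j| ≤ ε := by
  rcases eq_or_ne j i with rfl | hj
  · simpa [isingEstimate, hdiag] using hε
  have hlamexp : Real.exp (-(2 * lam)) * lam ≤ 1 / 2 := by
    have hinv : Real.exp (-(2 * lam)) * Real.exp (2 * lam) = 1 := by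
      rw [← Real.exp_add, neg_add_cancel, Real.exp_zero]
    nlinarith [Real.exp_pos (-(2 * lam)), Real.add_one_le_exp (2 * lam)]
  have hcurvature : 4 * Real.exp (-(2 * lam)) * lam ^ 2 * h ≤ 2 * (lam * h) := by
    linear_combination 4 * (lam * h) * hlamexp
  have hexp : ε ^ 2 * Real.exp (-(6 * lam)) ≤ ε ^ 2 * Real.exp (-(4 * lam)) :=
    mul_le_mul_of_nonneg_left (Real.exp_le_exp.2 (by linarith)) (sq_nonneg ε)
  have hsq : Real.exp (-(4 * lam)) * (A i j - isingEstimate lam T z i j) ^ 2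
      ≤ Real.exp (-(4 * lam)) * ε ^ 2 := by
    have herror := exp_mul_sq_sub_isingEstimate_le hA hdiag hwidth hlam hT hh hz hj
    have hpos : 0 ≤ ε ^ 2 * Real.exp (-(6 * lam)) := by positivity
    linarith
  exact abs_le_of_sq_le_sq (le_of_mul_le_mul_left hsq (Real.exp_pos _)) hε

theorem log_two_mul_add_one_le (hn : 2 ≤ n) : Real.log (2 * n + 1) ≤ 3 * Real.log n := by
  have hn' : (2 : ℝ) ≤ n := by exact_mod_cast hn
  rw [show (3 : ℝ) = (3 : ℕ) by norm_num, ← Real.log_pow]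
  refine Real.log_le_log (by positivity) ?_
  nlinarith [mul_nonneg (sub_nonneg.2 hn') (sq_nonneg (n : ℝ))]

theorem card_mul_exp_le (hn : 2 ≤ n) (hρ : 0 < ρ) (hρ₁ : ρ ≤ 1) (hN : 0 < N)
    (hh : h ^ 2 = 10 * Real.log (n / ρ) / N) :
    ((n : ℝ) ^ 2 + n ^ 3) * (2 * Real.exp (-(N * h ^ 2 / 2))) ≤ ρ := by
  have hn' : (2 : ℝ) ≤ n := by exact_mod_cast hn
  have hN' : (0 : ℝ) < N := by exact_mod_cast hN
  have hexp : Real.exp (-(N * h ^ 2 / 2)) = ρ ^ 5 / n ^ 5 := by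
    rw [hh, mul_div_cancel₀ _ hN'.ne',
      show -(10 * Real.log (n / ρ) / 2) = (5 : ℕ) * Real.log (n / ρ)⁻¹ by
        rw [Real.log_inv]; push_cast; ring,
      Real.exp_nat_mul, Real.exp_log (by positivity), inv_div, div_pow]
  have hpoly : ((n : ℝ) ^ 2 + n ^ 3) * 2 ≤ n ^ 5 := by
    have h₂ : 4 ≤ (n : ℝ) ^ 2 := by nlinarith
    have h₃ : 2 * (n : ℝ) ^ 2 ≤ n ^ 3 := by nlinarith [sq_nonneg (n : ℝ)]
    nlinarith [pow_pos (zero_lt_two.trans_le hn') 3]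
  calc ((n : ℝ) ^ 2 + n ^ 3) * (2 * Real.exp (-(N * h ^ 2 / 2)))
      = (((n : ℝ) ^ 2 + n ^ 3) * 2 / n ^ 5) * ρ ^ 5 := by rw [hexp]; ring
    _ ≤ 1 * ρ := mul_le_mul ((div_le_one (by positivity)).2 hpoly)
        (pow_le_of_le_one hρ.le hρ₁ (by norm_num)) (by positivity) zero_le_one
    _ = ρ := one_mul ρ

theorem mul_sqrt_div_le {X M a c : ℝ} (hlam : 0 < lam) (hε : 0 < ε) (hX : 0 < X) (hc : 0 ≤ c)
    (ha : a ≤ c ^ 2 * 1000)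
    (hM : 1000 * (lam ^ 2 * Real.exp (12 * lam) * X / ε ^ 4) ≤ M) :
    lam * √(a * X / M) ≤ c * (ε ^ 2 * Real.exp (-(6 * lam))) := by
  have hM₀ : 0 < M := lt_of_lt_of_le (by positivity) hM
  have hexp : Real.exp (-(6 * lam)) ^ 2 * Real.exp (12 * lam) = 1 := by
    rw [← Real.exp_nat_mul, ← Real.exp_add, Real.exp_eq_one_iff]
    push_cast
    ring
  rw [← le_div_iff₀' hlam]
  refine Real.sqrt_le_iff.2 ⟨by positivity, ?_⟩
  rw [div_le_iff₀ hM₀]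
  calc a * X ≤ c ^ 2 * 1000 * X := mul_le_mul_of_nonneg_right ha hX.le
    _ = c ^ 2 * 1000 * X * (Real.exp (-(6 * lam)) ^ 2 * Real.exp (12 * lam)) := by
      rw [hexp, mul_one]
    _ = (c * (ε ^ 2 * Real.exp (-(6 * lam))) / lam) ^ 2
        * (1000 * (lam ^ 2 * Real.exp (12 * lam) * X / ε ^ 4)) := by field_simp
    _ ≤ _ := mul_le_mul_of_nonneg_left hM (sq_nonneg _)

theorem ofReal_one_sub_le_isingSamples_of_width_pos (hA : A.IsSymm) (hdiag : ∀ i, A i i = 0)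
    (hwidth : isingWidth A θ ≤ lam) (hlam : 0 < lam) (hn : 2 ≤ n) (hρ : 0 < ρ) (hρ₁ : ρ < 1)
    (hε : 0 < ε)
    (hT : 1000 * (lam ^ 2 * Real.exp (12 * lam) * Real.log n / ε ^ 4) ≤ T)
    (hN : 1000 * (lam ^ 2 * Real.exp (12 * lam) * Real.log (n / ρ) / ε ^ 4) ≤ N) :
    ENNReal.ofReal (1 - ρ) ≤
      isingSamples A θ N {z | ∀ i j, |A i j - isingEstimate lam T z i j| ≤ ε} := by
  have hn' : (2 : ℝ) ≤ n := by exact_mod_cast hn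
  have hlogn : 0 < Real.log n := Real.log_pos (by linarith)
  have hlogρ : 0 < Real.log (n / ρ) := Real.log_pos ((one_lt_div hρ).2 (by linarith))
  have hTpos : (0 : ℝ) < T := lt_of_lt_of_le (by positivity) hT
  have hNpos : (0 : ℝ) < N := lt_of_lt_of_le (by positivity) hN
  set h := √(10 * Real.log (n / ρ) / N)
  have hstat : lam * h ≤ 1 / 10 * (ε ^ 2 * Real.exp (-(6 * lam))) :=
    mul_sqrt_div_le hlam hε hlogρ (by norm_num) (by norm_num) hN
  have hopt : lam * √(2 * Real.log (2 * n + 1) / T)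
      ≤ 2 / 25 * (ε ^ 2 * Real.exp (-(6 * lam))) :=
    calc lam * √(2 * Real.log (2 * n + 1) / T) ≤ lam * √(6 * Real.log n / T) := by
          gcongr _ * √(?_ / _)
          linarith [log_two_mul_add_one_le hn]
      _ ≤ _ := mul_sqrt_div_le hlam hε hlogn (by norm_num) (by norm_num) hT
  have hbad := card_mul_exp_le hn hρ hρ₁.le (Nat.cast_pos.1 hNpos) (Real.sq_sqrt (by positivity))
  calc ENNReal.ofReal (1 - ρ)
      ≤ ENNReal.ofReal ((isingSamples A θ N).real (concentratedSamples A θ N h)) :=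
        ENNReal.ofReal_le_ofReal ((sub_le_sub_left hbad 1).trans
          (one_sub_le_isingSamples_concentratedSamples (Nat.cast_pos.1 hNpos) (Real.sqrt_nonneg _)))
    _ ≤ isingSamples A θ N (concentratedSamples A θ N h) := ENNReal.ofReal_toReal_le
    _ ≤ _ := measure_mono fun _ hz i j => abs_sub_isingEstimate_le hA hdiag hwidth hlam hε.le
        (Nat.cast_pos.1 hTpos) (Real.sqrt_nonneg _) hopt hstat hz i j

theorem abs_le_isingWidth (A : Matrix (Fin n) (Fin n) ℝ) (θ : Fin n → ℝ) (i j : Fin n) :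
    |A i j| ≤ isingWidth A θ :=
  ((Finset.single_le_sum (f := fun j => |A i j|) (fun _ _ => abs_nonneg _)
    (Finset.mem_univ j)).trans (le_add_of_nonneg_right (abs_nonneg (θ i)))).trans
    (sum_abs_add_abs_le_isingWidth A θ i)

theorem isingEstimate_zero (T : ℕ) (z : Fin N → Fin n → ℤˣ) : isingEstimate 0 T z = 0 := by
  ext i j
  simp [isingEstimate, mirrorDescent]

theorem ofReal_one_sub_le_isingSamples (hA : A.IsSymm) (hdiag : ∀ i, A i i = 0)
    (hwidth : isingWidth A θ ≤ lam) (hρ : 0 < ρ) (hρ₁ : ρ < 1) (hε : 0 < ε)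
    (hT : 1000 * (lam ^ 2 * Real.exp (12 * lam) * Real.log n / ε ^ 4) ≤ T)
    (hN : 1000 * (lam ^ 2 * Real.exp (12 * lam) * Real.log (n / ρ) / ε ^ 4) ≤ N) :
    ENNReal.ofReal (1 - ρ) ≤
      isingSamples A θ N {z | ∀ i j, |A i j - isingEstimate lam T z i j| ≤ ε} := by
  by_cases hexact : ∀ z : Fin N → Fin n → ℤˣ, isingEstimate lam T z = A
  · simp only [hexact, sub_self, abs_zero, hε.le, implies_true, Set.ofPred_true, isingSamples,
      measure_univ]
    exact ENNReal.ofReal_le_one.2 (by linarith)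
  have hn : 2 ≤ n := by
    by_contra! hn
    refine hexact fun z => ?_
    ext i j
    obtain rfl : j = i := Fin.ext (by omega)
    rw [hdiag, isingEstimate, if_pos rfl]
  have hlam : 0 < lam := by
    refine ((isingWidth_nonneg A θ).trans hwidth).lt_of_ne fun hlam => hexact fun z => ?_
    subst hlam
    ext i j
    rw [isingEstimate_zero, Matrix.zero_apply]
    exact (abs_nonpos_iff.1 ((abs_le_isingWidth A θ i j).trans hwidth)).symm
  exact ofReal_one_sub_le_isingSamples_of_width_pos hA hdiag hwidth hlam hn hρ hρ₁ hε hT hN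

end Accuracy

/-! ### Running time for the stated numbers of iterations and samples -/

section RunningTime

variable {c L b : ℝ}

theorem one_le_ceil_mul_add (hc : 0 < c) (hL : 1 / 2 ≤ L) (hb : 0 ≤ b) :
    1 ≤ ⌈c * (L + b)⌉₊ :=
  Nat.ceil_pos.2 (mul_pos hc (by linarith))

theorem natCast_ceil_mul_add_le (hc : 0 < c) (hL : 1 / 2 ≤ L) (hb : 0 ≤ b) :
    (⌈c * (L + b)⌉₊ : ℝ) ≤ (c * (1 + 2 * b) + 2) * L := by
  have hceil := (Nat.ceil_lt_add_one (mul_nonneg hc.le (by linarith : 0 ≤ L + b))).le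
  linear_combination hceil + 2 * hL + 2 * mul_le_mul_of_nonneg_left hL (mul_nonneg hc.le hb)

theorem exists_forall_steps_le_mul_log_sq {lam ρ ε : ℝ} (hlam : 0 < lam) (hρ : 0 < ρ)
    (hρ₁ : ρ < 1) (hε : 0 < ε) :
    ∃ B : ℝ, ∀ (n N T : ℕ) (eta : ℝ) (z : Fin N → Fin n → ℤˣ), 2 ≤ n →
      T = ⌈1000 * (lam ^ 2 * Real.exp (12 * lam) * Real.log n / ε ^ 4)⌉₊ →
      N = ⌈1000 * (lam ^ 2 * Real.exp (12 * lam) * Real.log (n / ρ) / ε ^ 4)⌉₊ →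
      (IsingProgram.steps T lam eta z : ℝ) ≤ B * (n ^ 2 * Real.log n ^ 2) := by
  obtain ⟨c, hc⟩ : ∃ c, c = 1000 * (lam ^ 2 * Real.exp (12 * lam) / ε ^ 4) := ⟨_, rfl⟩
  have hcpos : 0 < c := by rw [hc]; positivity
  have hscale : ∀ X : ℝ, 1000 * (lam ^ 2 * Real.exp (12 * lam) * X / ε ^ 4) = c * X :=
    fun X => by rw [hc]; ring
  have hb : 0 ≤ -Real.log ρ := by linarith [Real.log_neg hρ hρ₁]
  refine ⟨2000 * ((c * (1 + 2 * 0) + 2) * (c * (1 + 2 * -Real.log ρ) + 2)),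
    fun n N T eta z hn hT hN => ?_⟩
  have hn' : (2 : ℝ) ≤ n := by exact_mod_cast hn
  have hlog : 1 / 2 ≤ Real.log n := by
    linarith [Real.log_le_log two_pos hn', Real.log_two_gt_d9]
  rw [hscale, ← add_zero (Real.log n)] at hT
  rw [hscale, Real.log_div (by linarith) hρ.ne', sub_eq_add_neg] at hN
  have hT₁ : 1 ≤ T := hT ▸ one_le_ceil_mul_add hcpos hlog le_rfl
  have hN₁ : 1 ≤ N := hN ▸ one_le_ceil_mul_add hcpos hlog hb
  have hTle : (T : ℝ) ≤ (c * (1 + 2 * 0) + 2) * Real.log n :=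
    (congrArg Nat.cast hT).trans_le (natCast_ceil_mul_add_le hcpos hlog le_rfl)
  have hNle : (N : ℝ) ≤ (c * (1 + 2 * -Real.log ρ) + 2) * Real.log n :=
    (congrArg Nat.cast hN).trans_le (natCast_ceil_mul_add_le hcpos hlog hb)
  calc (IsingProgram.steps T lam eta z : ℝ) ≤ 2000 * (T * N * n ^ 2) := by
        exact_mod_cast IsingProgram.steps_le lam eta z (by omega) hN₁ hT₁
    _ ≤ 2000 * (((c * (1 + 2 * 0) + 2) * Real.log n)
        * ((c * (1 + 2 * -Real.log ρ) + 2) * Real.log n) * n ^ 2) := by gcongr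
    _ = _ := by ring

end RunningTime

theorem mainTheorem5 :
    ∃ C : ℝ, 0 < C ∧
      -- statistical guarantee
      (∀ (n : ℕ) (A : Matrix (Fin n) (Fin n) ℝ) (θ : Fin n → ℝ) (lam ρ ε : ℝ) (N T : ℕ),
        A.IsSymm → (∀ i, A i i = 0) → isingWidth A θ ≤ lam →
        0 < ρ → ρ < 1 → 0 < ε →
        C * (lam ^ 2 * Real.exp (12 * lam) * Real.log n / ε ^ 4) ≤ T →
        C * (lam ^ 2 * Real.exp (12 * lam) * Real.log (n / ρ) / ε ^ 4) ≤ N →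
        ENNReal.ofReal (1 - ρ) ≤
          isingSamples A θ N {z | ∀ i j, |A i j - isingEstimate lam T z i j| ≤ ε}) ∧
      -- the program computes the estimates
      (∀ (n N T : ℕ) (lam eta : ℝ) (z : Fin N → Fin n → ℤˣ),
        (∀ i j : Fin n, (IsingProgram.output T lam eta z).arr .Ahat (i * n + j)
          = isingEstimate lam T z i j) ∧
        (∀ i j : Fin n,
          ((isingGraphEstimate lam eta T z).Adj i j →
            (IsingProgram.output T lam eta z).arr .edge (i * n + j) = 1) ∧
          (¬ (isingGraphEstimate lam eta T z).Adj i j →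
            (IsingProgram.output T lam eta z).arr .edge (i * n + j) = 0))) ∧
      -- its running time is `O(T N n²)`
      (∃ K : ℝ, ∀ (n N T : ℕ) (lam eta : ℝ) (z : Fin N → Fin n → ℤˣ),
        1 ≤ n → 1 ≤ N → 1 ≤ T →
        (IsingProgram.steps T lam eta z : ℝ) ≤ K * (T * N * n ^ 2)) ∧
      -- which is `O(n² (ln n)²)` for the stated numbers of iterations and samples
      (∀ lam ρ ε : ℝ, 0 < lam → 0 < ρ → ρ < 1 → 0 < ε →
        ∃ B : ℝ, ∀ (n N T : ℕ) (eta : ℝ) (z : Fin N → Fin n → ℤˣ), 2 ≤ n →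
          T = ⌈C * (lam ^ 2 * Real.exp (12 * lam) * Real.log n / ε ^ 4)⌉₊ →
          N = ⌈C * (lam ^ 2 * Real.exp (12 * lam) * Real.log (n / ρ) / ε ^ 4)⌉₊ →
          (IsingProgram.steps T lam eta z : ℝ) ≤ B * (n ^ 2 * Real.log n ^ 2)) := by
  refine ⟨1000, by norm_num, ?guarantee, fun n N T lam eta z => ⟨?weights, ?edges⟩, ?time, ?rate⟩
  case guarantee =>
    intro n A θ lam ρ ε N T hA hdiag hwidth hρ hρ₁ hε hT hN
    exact ofReal_one_sub_le_isingSamples hA hdiag hwidth hρ hρ₁ hε hT hN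
  case weights => exact IsingProgram.holdsMatrix_Ahat_output T lam eta z
  case edges =>
    intro i j
    constructor <;> intro h <;>
      simpa [h] using IsingProgram.holdsMatrix_edge_output T lam eta z i j
  case time =>
    refine ⟨2000, fun n N T lam eta z hn hN hT => ?_⟩
    exact_mod_cast IsingProgram.steps_le lam eta z hn hN hT
  case rate =>
    intro lam ρ ε hlam hρ hρ₁ hε
    exact exists_forall_steps_le_mul_log_sq hlam hρ hρ₁ hε
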